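/- Let $\mathbb{K}$ be an algebraically closed field, $k\ge 3$, $d=2k$, and let $u_0,u_1,u_2\in\mathbb{K}[T]=\mathbb{K}[T_0,T_1]$ be forms of degree $d$ without common factor such that $\phi=(u_0:u_1:u_2):\mathbb{P}^1\to\mathbb{P}^2$ is birational onto its image curve $C$. Let $X=(X_0,X_1,X_2)$, and let $\mathcal{K}\subset\mathbb{K}[T,X]$ be the kernel of the $\mathbb{K}[T]$-algebra map $\mathbb{K}[T,X]\to\mathbb{K}[T][Z]$, $X_i\mapsto u_iZ$ (the defining ideal of the Rees algebra of $\langle u_0,u_1,u_2\rangle$). Write $\mathcal{K}_{i,j}$ for its part of bidegree $(i,j)$ in $(T,X)$ and $\mathcal{K}_{1,*}=\bigoplus_j\mathcal{K}_{1,j}$. Let $\mathcal{E}_d(X)$ be the irreducible polynomial defining $C$, i.e. an irreducible generator of $\mathcal{K}\cap\mathbb{K}[X]$. Assume that $\mu=2$: the syzygy module of $(u_0,u_1,u_2)$ has a $\mathbb{K}[T]$-basis consisting of homogeneous syzygies of degrees $2$ and $d-2$; let $F_{2,1}\in\mathcal{K}_{2,1}$ and $F_{d-2,1}\in\mathcal{K}_{d-2,1}$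 be the corresponding forms, linear in $X$. Assume also that $(0:0:1)$ is a very singular point of $C$, i.e. its multiplicity on $C$ is larger than $\mu=2$; then $F_{2,1}=p^1(T)X_0-p^0(T)X_1$ with $p^0,p^1$ forms of degree $2$. If $G=p^0G^0+p^1G^1$ with $G^0,G^1$ bihomogeneous of the same bidegree, put $\mathcal{D}_T(G)=X_0G^0+X_1G^1$; if $G=X_0G^0+X_1G^1$ with $G^0,G^1$ bihomogeneous of the same bidegree, put $\mathcal{D}_X(G)=p^0G^0+p^1G^1$. (Both depend on the chosen decomposition; different choices agree modulo $F_{2,1}$.) For $j=2,\dots,k-1$ let $F_{2(k-j),j}=\mathcal{D}_T(F_{2(k-j+1),j-1})$, for any choices of the decompositions. Write $$F_{2,1}=T_0^2\mathcal{F}^0+T_0T_1\mathcal{F}^*+T_1^2\mathcal{F}^1,\qquad F_{2,k-1}=T_0^2\mathcal{M}^0+T_0T_1\mathcal{M}^*+T_1^2\mathcal{M}^1$$ with coefficients in $\mathbb{K}[X]$. Then there are unique polynomials $F^0_{1,k},F^1_{1,k}\in\mathbb{K}[T,X]$ with $$\mathcal{M}^0F_{2,1}-\mathcal{F}^0F_{2,k-1}=T_1F^0_{1,k},\qquad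 \mathcal{M}^1F_{2,1}-\mathcal{F}^1F_{2,k-1}=T_0F^1_{1,k},$$ and the following hold. 1. $F^i_{1,k}\in\mathcal{K}_{1,k}\cap\langle X_0,X_1\rangle$ for $i=0,1$. 2. Writing $F^i_{1,k}=T_0\mathcal{F}^{i,0}-T_1\mathcal{F}^{i,1}$ with $\mathcal{F}^{i,0},\mathcal{F}^{i,1}\in\mathbb{K}[X]$, one has, up to nonzero constants in $\mathbb{K}$, $$\mathcal{F}^{0,0}\mathcal{F}^{1,1}-\mathcal{F}^{1,0}\mathcal{F}^{0,1}=\mathrm{Res}_T(F^0_{1,k},F^1_{1,k})=\mathcal{E}_d.$$ 3. $\{F^0_{1,k},F^1_{1,k}\}$ is a basis of the $\mathbb{K}[X]$-module $\mathcal{K}_{1,*}$. 4. For $i=0,1$, $\mathcal{D}_X(F^i_{1,k})$ is defined, and each of its values is congruent modulo $F_{2,1}$ to a multiple of $F_{2,k-1}$. -/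

import Mathlib

open MvPolynomial

namespace ReesCurve

/-- `𝕂[T₀,T₁]`. -/
abbrev PolyT (K : Type*) [Field K] := MvPolynomial (Fin 2) K

/-- `𝕂[X₀,X₁,X₂]`. -/
abbrev PolyX (K : Type*) [Field K] := MvPolynomial (Fin 3) K

/-- `𝕂[T,X]`, presented as polynomials in `T₀,T₁` over `𝕂[X₀,X₁,X₂]`. -/
abbrev PolyTX (K : Type*) [Field K] := MvPolynomial (Fin 2) (PolyX K)

section

variable {K : Type*} [Field K]

/-- The inclusion `𝕂[T] → 𝕂[T,X]`. The inclusion `𝕂[X] → 𝕂[T,X]` is `MvPolynomial.C`. -/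
noncomputable def inclT : PolyT K →+* PolyTX K := MvPolynomial.map MvPolynomial.C

/-- The variable `T_i` of `𝕂[T,X]`. -/
noncomputable def varT (i : Fin 2) : PolyTX K := MvPolynomial.X i

/-- The variable `X_i` of `𝕂[T,X]`. -/
noncomputable def varX (i : Fin 3) : PolyTX K := MvPolynomial.C (MvPolynomial.X i)

/-- `G` is bihomogeneous of bidegree `(i, j)` in `(T, X)` (zero is allowed). -/
def IsBihom (G : PolyTX K) (i j : ℕ) : Prop :=
  G.IsHomogeneous i ∧ ∀ m, (G.coeff m).IsHomogeneous j

/-- The map `T_i ↦ T_i`, `X_i ↦ u_i Z` to `𝕂[T][Z]`; its image is the Rees algebra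
`⊕ₙ Iⁿ Zⁿ` of `I = ⟨u₀, u₁, u₂⟩`. -/
noncomputable def reesMap (u : Fin 3 → PolyT K) : PolyTX K →+* Polynomial (PolyT K) :=
  eval₂Hom
    (eval₂Hom (Polynomial.C.comp MvPolynomial.C)
      (fun i => Polynomial.C (u i) * Polynomial.X))
    (fun i => Polynomial.C (MvPolynomial.X i))

/-- The defining ideal `𝒦` of the Rees algebra. -/
noncomputable def reesIdeal (u : Fin 3 → PolyT K) : Ideal (PolyTX K) :=
  RingHom.ker (reesMap u)

/-- The `𝕂[X]`-module `𝒦_{1,*}` of the elements of `𝒦` that are homogeneous of degree one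
in `T`. -/
noncomputable def reesIdealOne (u : Fin 3 → PolyT K) : Submodule (PolyX K) (PolyTX K) :=
  homogeneousSubmodule (Fin 2) (PolyX K) 1 ⊓ (reesIdeal u).restrictScalars (PolyX K)

/-- `u₀, u₁, u₂` are homogeneous of degree `d` and have no common factor. -/
def IsParametrization (d : ℕ) (u : Fin 3 → PolyT K) : Prop :=
  (∀ i, (u i).IsHomogeneous d) ∧ ∀ g : PolyT K, (∀ i, g ∣ u i) → IsUnit g

/-- The map `φ = (u₀ : u₁ : u₂)` is birational onto its image: there is a rational map
`ψ = (A : B)` from the image curve to `ℙ¹` (so `A, B` are forms of the same degree that do not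
both vanish identically on the curve) with `ψ ∘ φ = id`. As `φ` is dominant onto its image,
`φ ∘ ψ = id` then holds as well. -/
def IsProper (u : Fin 3 → PolyT K) : Prop :=
  ∃ (l : ℕ) (A B : PolyX K), A.IsHomogeneous l ∧ B.IsHomogeneous l ∧
    (aeval u A ≠ 0 ∨ aeval u B ≠ 0) ∧
    (MvPolynomial.X 0 : PolyT K) * aeval u B = MvPolynomial.X 1 * aeval u A

/-- The syzygy module of `(u₀, u₁, u₂)`. -/
noncomputable def syz (u : Fin 3 → PolyT K) : Submodule (PolyT K) (Fin 3 → PolyT K) :=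
  LinearMap.ker (Fintype.linearCombination (PolyT K) u)

/-- `P, Q` is a `μ`-basis of the degree-`d` parametrization `u`: a basis of the syzygy module
whose members are homogeneous of degrees `μ` and `d - μ`, with `μ ≤ d - μ`. -/
def IsMuBasis (d μ : ℕ) (u P Q : Fin 3 → PolyT K) : Prop :=
  2 * μ ≤ d ∧ (∀ i, (P i).IsHomogeneous μ) ∧ (∀ i, (Q i).IsHomogeneous (d - μ)) ∧
    LinearIndependent (PolyT K) ![P, Q] ∧
    Submodule.span (PolyT K) {P, Q} = syz u

/-- The element `∑ aᵢ(T) Xᵢ` of `𝕂[T,X]` attached to a syzygy `a`. -/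
noncomputable def syzForm (a : Fin 3 → PolyT K) : PolyTX K :=
  ∑ i, inclT (a i) * varX i

/-- `E` is an implicit equation of the image curve: an irreducible polynomial that generates
`𝒦 ∩ 𝕂[X]`. -/
def IsImplicitEquation (u : Fin 3 → PolyT K) (E : PolyX K) : Prop :=
  Irreducible E ∧ Ideal.span {E} = (reesIdeal u).comap MvPolynomial.C

/-- The multiplicity of the plane curve `E = 0` at the point with homogeneous coordinates
`p`: the order of vanishing of the form `E` at `p`, that is, the order of `E(p + X)`. -/
noncomputable def multAt (E : PolyX K) (p : Fin 3 → K) : ℕ∞ :=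
  ((aeval (fun i => MvPolynomial.X i + MvPolynomial.C (p i)) E : PolyX K) :
    MvPowerSeries (Fin 3) K).order

/-- `H` is a value of the operator `𝒟_T` (with respect to `p⁰, p¹` of degree `μ`) at the form
`G` of bidegree `(i + μ, j)`: for some decomposition `G = p⁰ G⁰ + p¹ G¹` with `G⁰, G¹` of
bidegree `(i, j)` one has `H = X₀ G⁰ + X₁ G¹`. -/
def IsDT (p0 p1 : PolyT K) (i j : ℕ) (G H : PolyTX K) : Prop :=
  ∃ G0 G1 : PolyTX K, IsBihom G0 i j ∧ IsBihom G1 i j ∧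
    G = inclT p0 * G0 + inclT p1 * G1 ∧ H = varX 0 * G0 + varX 1 * G1

/-- `H` is a value of the operator `𝒟_X` at the form `G ∈ ⟨X₀, X₁⟩` of bidegree `(i, j + 1)`:
for some decomposition `G = X₀ G⁰ + X₁ G¹` with `G⁰, G¹` of bidegree `(i, j)` one has
`H = p⁰ G⁰ + p¹ G¹`. -/
def IsDX (p0 p1 : PolyT K) (i j : ℕ) (G H : PolyTX K) : Prop :=
  ∃ G0 G1 : PolyTX K, IsBihom G0 i j ∧ IsBihom G1 i j ∧
    G = varX 0 * G0 + varX 1 * G1 ∧ H = inclT p0 * G0 + inclT p1 * G1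

/-- The family of `F_{2(k-j), j}`, `1 ≤ j ≤ k - 1`, for `d = 2k` and `μ = 2`, written
`F j = F_{2(k-j), j}`: it starts with `F 1 = Q`, and `F (j + 1)` is any value of `𝒟_T` at
`F j`. With `P = p¹ X₀ - p⁰ X₁` the operator is taken with respect to `p⁰ = -P₁`, `p¹ = P₀`. -/
def IsDTFamily (k : ℕ) (P Q : Fin 3 → PolyT K) (F : ℕ → PolyTX K) : Prop :=
  F 1 = syzForm Q ∧
    ∀ j, 1 ≤ j → j + 1 ≤ k - 1 → IsDT (-P 1) (P 0) (2 * (k - (j + 1))) j (F j) (F (j + 1))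

/-- The coefficient, in `𝕂[X]`, of `T₀ᵃ T₁ᵇ` in `G`. -/
noncomputable def coeffT (a b : ℕ) (G : PolyTX K) : PolyX K :=
  G.coeff (Finsupp.single 0 a + Finsupp.single 1 b)

/-- `L 0, L 1` are the forms `F⁰_{1,k}, F¹_{1,k}` obtained from two forms `F, M` of `T`-degree
two by eliminating `T₀²`, respectively `T₁²`, and dividing by `T₁`, respectively `T₀`. -/
def IsLinearPair (F M : PolyTX K) (L : Fin 2 → PolyTX K) : Prop :=
  MvPolynomial.C (coeffT 2 0 M) * F - MvPolynomial.C (coeffT 2 0 F) * M = varT 1 * L 0 ∧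
  MvPolynomial.C (coeffT 0 2 M) * F - MvPolynomial.C (coeffT 0 2 F) * M = varT 0 * L 1

/-- The coefficients `ℱ^{i,0}, ℱ^{i,1}` in `L = T₀ ℱ^{i,0} - T₁ ℱ^{i,1}`. -/
noncomputable def linCoeff (L : PolyTX K) : Fin 2 → PolyX K :=
  ![coeffT 1 0 L, -coeffT 0 1 L]

/-- The resultant with respect to `T` of two forms of `T`-degrees `m` and `n`: the Sylvester
determinant of their coefficients. -/
noncomputable def resT (m n : ℕ) (G H : PolyTX K) : PolyX K :=
  Polynomial.resultant
    (aeval ![Polynomial.X, (1 : Polynomial (PolyX K))] G)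
    (aeval ![Polynomial.X, (1 : Polynomial (PolyX K))] H) m n

end

end ReesCurve

/-! The cross product of the two basis syzygies `P`, `Q` is a nonzero constant times `u`
(`exists_cross_eq_smul`). The implicit equation `E` divides the resultant of the two moving lines.
If `P 2` were nonzero, that resultant would vanish to order at most 2 along a general line through
(0:0:1), against multiplicity > 2; so `P 2 = 0` (`eq_zero_of_two_lt_multAt`). Hence u₀ = g p⁰ and u₁
= g p¹, where p = (p⁰ : p¹) is a base-point-free pencil of degree 2.

Where (X₀, X₁) = λ p(T), every 𝒟_T multiplies values by λ, whatever the decompositions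
(`IsDTFamily.evalTX_eq`). So F_{2,k-1} takes the value λ^(k-2) F_{d-2,1} there. This puts F_{2,k-1}
in 𝒦, and it shows that at a root T of F_{2,1} over a line through (0:0:1), F_{2,k-1} is a nonzero
polynomial in X₂ of degree at most 1.

The determinant D of the two linear forms is, up to sign, the Bézout form of Res_T(F_{2,1},
F_{2,k-1}). On each line through (0:0:1) it is minus the product of the values of F_{2,k-1} at the
two roots of F_{2,1}, so it is nonzero of degree at most 2 in X₂ (`exists_eval_linDet_line`). Now E
divides D, and E has X₂-degree at least 2: otherwise (x₀ : x₁) would determine the point of C, and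
birationality would give the degree 2 map p a left inverse (`two_le_natDegree_toPolyX2`). The
cofactor is thus a form in X₀, X₁; a zero of it would be a line on which D vanishes, so it is
constant.

Cramer's rule then gives the basis of 𝒦_{1,*} (`span_eq_reesIdealOne`), and 𝒟_X is computed by the
three-term identity `mul_linearPair_sub_mul_linearPair`. -/

namespace ReesCurve

/-! ### Homogeneous polynomials and zeros of binary forms. -/

section Forms

variable {K : Type*} [Field K]

theorem aeval_mul_of_isHomogeneous {σ R S : Type*} [CommRing R] [CommRing S] [Algebra R S]
    {h : MvPolynomial σ R} {n : ℕ} (hh : h.IsHomogeneous n) (c : S) (g : σ → S) :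
    aeval (fun i => c * g i) h = c ^ n * aeval g h := by
  rw [aeval_def, aeval_def, eval₂_eq, eval₂_eq, Finset.mul_sum]
  refine Finset.sum_congr rfl fun d hd => ?_
  have hdeg := hh.degree_eq_sum_deg_support hd
  simp only [mul_pow, Finset.prod_mul_distrib, Finset.prod_pow_eq_pow_sum]
  rw [← hdeg]
  ring

theorem eval_mul_of_isHomogeneous {σ R : Type*} [CommRing R]
    {h : MvPolynomial σ R} {n : ℕ} (hh : h.IsHomogeneous n) (c : R) (g : σ → R) :
    eval (fun i => c * g i) h = c ^ n * eval g h := by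
  simpa [aeval_eq_eval] using aeval_mul_of_isHomogeneous hh c g

/-- Order never exceeds total degree, with equality exactly for forms, and both are additive on
products: equality for the product forces it for each factor. -/
theorem isHomogeneous_left_of_mul {σ : Type*} {f g : MvPolynomial σ K} {n : ℕ}
    (hfg : (f * g).IsHomogeneous n) (h0 : f * g ≠ 0) : f.IsHomogeneous f.totalDegree := by
  have hf : f ≠ 0 := left_ne_zero_of_mul h0
  have hg : g ≠ 0 := right_ne_zero_of_mul h0
  have key : ∀ p : MvPolynomial σ K, p ≠ 0 → (p : MvPowerSeries σ K).order ≤ p.totalDegree := by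
    intro p hp
    obtain ⟨d, hd⟩ := exists_coeff_ne_zero hp
    refine (MvPowerSeries.order_le (d := d) (by simpa using hd)).trans ?_
    exact_mod_cast le_totalDegree (mem_support_iff.2 hd)
  have h1 : (n : ℕ∞) ≤ ((f * g : MvPolynomial σ K) : MvPowerSeries σ K).order := by
    refine MvPowerSeries.le_order fun d hd => ?_
    rw [MvPolynomial.coeff_coe]
    exact hfg.coeff_eq_zero (by intro h; simp [h] at hd)
  have h2 : f.totalDegree + g.totalDegree = n := by
    rw [← totalDegree_mul_of_isDomain hf hg]; exact hfg.totalDegree h0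
  rw [MvPolynomial.coe_mul, MvPowerSeries.order_mul, ← h2] at h1
  have hford : (f.totalDegree : ℕ∞) ≤ (f : MvPowerSeries σ K).order := by
    by_contra hlt
    push Not at hlt
    have := key g hg
    have h3 : (f : MvPowerSeries σ K).order + (g : MvPowerSeries σ K).order
        < (f.totalDegree : ℕ∞) + g.totalDegree :=
      ENat.add_lt_add_of_lt_of_le (by exact ne_top_of_le_ne_top (ENat.natCast_ne_top _) this) hlt this
    push_cast at h1
    exact absurd h1 (not_le.2 h3)
  intro d hd
  have h4 : d.degree ≤ f.totalDegree := le_totalDegree (mem_support_iff.2 hd)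
  have h5 : (f.totalDegree : ℕ∞) ≤ d.degree :=
    hford.trans (MvPowerSeries.order_le (d := d) (by simpa using hd))
  have h6 : f.totalDegree ≤ d.degree := by exact_mod_cast h5
  have h7 := le_antisymm h4 h6
  rwa [Finsupp.degree_eq_weight_one] at h7

theorem IsHomogeneous.eq_sum_binary {R : Type*} [CommRing R] {h : MvPolynomial (Fin 2) R} {n : ℕ}
    (hh : h.IsHomogeneous n) :
    h = ∑ i ∈ Finset.range (n + 1),
      C (h.coeff (Finsupp.single 0 i + Finsupp.single 1 (n - i))) * (X 0 ^ i * X 1 ^ (n - i)) := by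
  classical
  have hm : ∀ i j (a : R), C a * (X 0 ^ i * X 1 ^ j : MvPolynomial (Fin 2) R)
      = monomial (Finsupp.single 0 i + Finsupp.single 1 j) a := by
    intro i j a
    rw [X_pow_eq_monomial, X_pow_eq_monomial, monomial_mul, C_mul_monomial]; simp
  have hd2 : ∀ d : Fin 2 →₀ ℕ, d = Finsupp.single 0 (d 0) + Finsupp.single 1 (d 1) := by
    intro d; ext i; fin_cases i <;> simp
  ext d
  simp only [hm, coeff_sum, coeff_monomial]
  by_cases hd : d.degree = n
  · have hdd : d 0 + d 1 = n := by rw [← hd, Finsupp.degree_eq_sum]; simp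
    rw [Finset.sum_eq_single (d 0)]
    · have : n - d 0 = d 1 := by omega
      rw [this, ← hd2 d]; simp
    · intro i _ hi
      rw [if_neg]
      intro h; apply hi
      rw [← h]; simp
    · intro h; exfalso; apply h; simp; omega
  · rw [hh.coeff_eq_zero hd, Finset.sum_eq_zero]
    intro i hi
    rw [if_neg]
    rintro rfl
    apply hd
    simp at hi
    simp [Finsupp.degree_eq_sum]; omega

theorem exists_eval_eq_zero_of_isHomogeneous [IsAlgClosed K] {h : MvPolynomial (Fin 2) K} {n : ℕ}
    (hh : h.IsHomogeneous n) (hn : 0 < n) : ∃ r : Fin 2 → K, r ≠ 0 ∧ eval r h = 0 := by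
  by_cases h1 : eval ![1, 0] h = 0
  · exact ⟨_, by intro h; simpa using congrFun h 0, h1⟩
  set c : ℕ → K := fun i => h.coeff (Finsupp.single 0 i + Finsupp.single 1 (n - i)) with hc
  have hev : ∀ r : Fin 2 → K, eval r h
      = ∑ i ∈ Finset.range (n + 1), c i * (r 0 ^ i * r 1 ^ (n - i)) := by
    intro r
    conv_lhs => rw [IsHomogeneous.eq_sum_binary hh]
    simp [hc]
  have hcn : c n ≠ 0 := by
    rw [hev, Finset.sum_range_succ, Finset.sum_eq_zero] at h1
    · simpa using h1
    · intro i hi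
      simp at hi
      simp [show n - i ≠ 0 by omega]
  set f : Polynomial K := ∑ i ∈ Finset.range (n + 1), Polynomial.C (c i) * Polynomial.X ^ i with hf
  have hfc : f.coeff n = c n := by
    rw [hf, Polynomial.finsetSum_coeff, Finset.sum_eq_single n] <;>
      simp [Polynomial.coeff_X_pow]
    intro b _ hb h; exact absurd h.symm hb
  have hdeg : f.degree ≠ 0 := by
    intro h0
    have := Polynomial.coeff_eq_zero_of_degree_lt (p := f) (n := n) (by rw [h0]; exact_mod_cast hn)
    exact hcn (hfc ▸ this)
  obtain ⟨z, hz⟩ := IsAlgClosed.exists_root f hdeg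
  refine ⟨![z, 1], by intro h; simpa using congrFun h 1, ?_⟩
  rw [hev]
  simpa [hf, Polynomial.IsRoot, Polynomial.eval_finsetSum] using hz

/-- The linear form vanishing at `r`. -/
noncomputable def lineThrough (r : Fin 2 → K) : MvPolynomial (Fin 2) K :=
  C (r 0) * X 1 - C (r 1) * X 0

theorem lineThrough_isHomogeneous (r : Fin 2 → K) : (lineThrough r).IsHomogeneous 1 :=
  ((isHomogeneous_X _ _).C_mul _).sub ((isHomogeneous_X _ _).C_mul _)

theorem lineThrough_ne_zero {r : Fin 2 → K} (hr : r ≠ 0) : lineThrough r ≠ 0 := by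
  intro h
  apply hr
  have h1 := congrArg (eval ![1, 0]) h
  have h2 := congrArg (eval ![0, 1]) h
  simp [lineThrough] at h1 h2
  ext i; fin_cases i <;> simp [h1, h2]

/-- Modulo the linear form, r_j X_i = X_j r_i, so by homogeneity r_j^n h(X) = X_j^n h(r) = 0; some
r_j is a unit. -/
theorem lineThrough_dvd_of_eval_eq_zero {h : MvPolynomial (Fin 2) K} {n : ℕ}
    (hh : h.IsHomogeneous n) {r : Fin 2 → K} (hr : r ≠ 0) (h0 : eval r h = 0) :
    lineThrough r ∣ h := by
  rw [← Ideal.mem_span_singleton, ← Ideal.Quotient.eq_zero_iff_mem]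
  set π := Ideal.Quotient.mkₐ K (Ideal.span {lineThrough r})
  have hrel : algebraMap K _ (r 0) * π (X 1) = algebraMap K _ (r 1) * π (X 0) := by
    rw [← AlgHom.commutes π, ← AlgHom.commutes π, ← map_mul, ← map_mul, ← sub_eq_zero, ← map_sub]
    exact Ideal.Quotient.eq_zero_iff_mem.2 (Ideal.mem_span_singleton_self _)
  have hπ : ∀ p, π p = aeval (fun i => π (X i)) p := fun p => by
    rw [← aeval_X_left_apply (R := K) p, ← comp_aeval_apply]; simp
  have key : ∀ j : Fin 2, r j ≠ 0 → π h = 0 := by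
    intro j hj
    have e1 : (fun i => algebraMap K (MvPolynomial (Fin 2) K ⧸ Ideal.span {lineThrough r}) (r j)
        * π (X i)) = fun i => π (X j) * algebraMap K _ (r i) := by
      funext i
      fin_cases i <;> fin_cases j <;> simp [mul_comm] <;>
        first | simpa [mul_comm] using hrel | simpa [mul_comm] using hrel.symm
    have e2 := aeval_mul_of_isHomogeneous hh
      (algebraMap K (MvPolynomial (Fin 2) K ⧸ Ideal.span {lineThrough r}) (r j))
      (fun i => π (X i))
    rw [e1, aeval_mul_of_isHomogeneous hh, ← hπ,
      show (fun i => algebraMap K (MvPolynomial (Fin 2) K ⧸ Ideal.span {lineThrough r}) (r i))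
        = algebraMap K _ ∘ r from rfl, aeval_algebraMap_apply, aeval_eq_eval, h0] at e2
    rw [map_zero, mul_zero, ← map_pow] at e2
    have hu : IsUnit (algebraMap K (MvPolynomial (Fin 2) K ⧸ Ideal.span {lineThrough r}) (r j ^ n)) :=
      (IsUnit.mk0 _ (pow_ne_zero _ hj)).map _
    exact (hu.mul_right_eq_zero).1 e2.symm
  obtain ⟨j, hj⟩ := Function.ne_iff.1 hr
  exact key j hj

theorem not_isUnit_of_isHomogeneous {σ : Type*} {h : MvPolynomial σ K} {n : ℕ}
    (hh : h.IsHomogeneous n) (hn : 0 < n) : ¬ IsUnit h := by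
  intro hu
  have h1 := hh.totalDegree hu.ne_zero
  have h2 := (isUnit_iff_totalDegree_of_isReduced.1 hu).2
  omega

end Forms

end ReesCurve

namespace ReesCurve

/-! ### The syzygy module and the cross product. -/

section Syzygies

variable {K : Type*} [Field K] {d : ℕ} {u P Q : Fin 3 → PolyT K}

theorem exists_eval_ne_zero_of_isParametrization (hu : IsParametrization d u) {r : Fin 2 → K}
    (hr : r ≠ 0) : ∃ i, eval r (u i) ≠ 0 := by
  by_contra! h
  have := hu.2 (lineThrough r) fun i => lineThrough_dvd_of_eval_eq_zero (hu.1 i) hr (h i)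
  exact not_isUnit_of_isHomogeneous (lineThrough_isHomogeneous r) one_pos this

theorem dvd_of_forall_dvd_mul {R : Type*} [CommRing R] [IsDomain R] [UniqueFactorizationMonoid R]
    {u : Fin 3 → R} (hu : ∀ g : R, (∀ i, g ∣ u i) → IsUnit g) {a m : R}
    (h : ∀ i, a ∣ u i * m) : a ∣ m := by
  classical
  let _ := UniqueFactorizationMonoid.toGCDMonoid R
  have h1 : a ∣ gcd (gcd (u 0) (u 1)) (u 2) * m := by
    refine (dvd_gcd ?_ (h 2)).trans (gcd_mul_right' _ _ _).dvd
    exact (dvd_gcd (h 0) (h 1)).trans (gcd_mul_right' _ _ _).dvd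
  have h2 : IsUnit (gcd (gcd (u 0) (u 1)) (u 2)) := by
    apply hu
    intro i
    fin_cases i
    · exact (gcd_dvd_left _ _).trans (gcd_dvd_left _ _)
    · exact (gcd_dvd_left _ _).trans (gcd_dvd_right _ _)
    · exact gcd_dvd_right _ _
  exact (h2.dvd_mul_left).1 h1

theorem mem_syz_iff {a : Fin 3 → PolyT K} :
    a ∈ syz u ↔ a 0 * u 0 + a 1 * u 1 + a 2 * u 2 = 0 := by
  simp [syz, Fintype.linearCombination_apply, Fin.sum_univ_three]

/-- The Hilbert–Burch relation: P × Q and `u` are both orthogonal to P and Q, hence proportional. As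
the `u i` have no common factor, P × Q is a multiple of `u`, and equal degrees make the multiplier
constant. -/
theorem exists_cross_eq_smul (hu : IsParametrization d u) {μ : ℕ} (hμ : μ ≤ d)
    (hP : ∀ i, (P i).IsHomogeneous μ) (hQ : ∀ i, (Q i).IsHomogeneous (d - μ))
    (hli : LinearIndependent (PolyT K) ![P, Q]) (hPs : P ∈ syz u) (hQs : Q ∈ syz u) :
    ∃ c : K, c ≠ 0 ∧ P 1 * Q 2 - P 2 * Q 1 = C c * u 0 ∧
      P 2 * Q 0 - P 0 * Q 2 = C c * u 1 ∧ P 0 * Q 1 - P 1 * Q 0 = C c * u 2 := by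
  rw [mem_syz_iff] at hPs hQs
  set m : Fin 3 → PolyT K :=
    ![P 1 * Q 2 - P 2 * Q 1, P 2 * Q 0 - P 0 * Q 2, P 0 * Q 1 - P 1 * Q 0] with hm
  have hmh : ∀ i, (m i).IsHomogeneous d := by
    have hsum : ∀ a b, (P a * Q b).IsHomogeneous d := fun a b => by
      have := (hP a).mul (hQ b)
      rwa [Nat.add_sub_cancel' hμ] at this
    intro i
    match i with
    | 0 => exact (hsum 1 2).sub (hsum 2 1)
    | 1 => exact (hsum 2 0).sub (hsum 0 2)
    | 2 => exact (hsum 0 1).sub (hsum 1 0)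
  have hprop : ∀ i j, u i * m j = u j * m i := by
    have h01 : u 0 * m 1 = u 1 * m 0 := by
      simp only [hm, Matrix.cons_val]; linear_combination P 2 * hQs - Q 2 * hPs
    have h02 : u 0 * m 2 = u 2 * m 0 := by
      simp only [hm, Matrix.cons_val]; linear_combination Q 1 * hPs - P 1 * hQs
    have h12 : u 1 * m 2 = u 2 * m 1 := by
      simp only [hm, Matrix.cons_val]; linear_combination P 0 * hQs - Q 0 * hPs
    intro i j
    match i, j with
    | 0, 0 | 1, 1 | 2, 2 => rfl
    | 0, 1 => exact h01
    | 0, 2 => exact h02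
    | 1, 2 => exact h12
    | 1, 0 => exact h01.symm
    | 2, 0 => exact h02.symm
    | 2, 1 => exact h12.symm
  have hm0 : ∃ i, m i ≠ 0 := by
    by_contra! h
    have h0 := h 0
    have h1 := h 1
    have h2 := h 2
    simp only [hm, Matrix.cons_val] at h0 h1 h2
    rw [LinearIndependent.pair_iff] at hli
    have hPQ : ∀ i j, Q i * P j + (-P i) * Q j = 0 := by
      intro i j
      match i, j with
      | 0, 0 | 1, 1 | 2, 2 => ring
      | 0, 1 => linear_combination -h2
      | 0, 2 => linear_combination h1
      | 1, 2 => linear_combination -h0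
      | 1, 0 => linear_combination h2
      | 2, 0 => linear_combination -h1
      | 2, 1 => linear_combination h0
    have hPz : ∀ i, P i = 0 := fun i => by
      have := (hli (Q i) (-P i) (by ext1 j; simpa using hPQ i j)).2
      simpa using this
    have := (hli 1 0 (by ext1 j; simp [hPz])).1
    exact one_ne_zero this
  obtain ⟨i, hi⟩ := hm0
  have hui : u i ≠ 0 := by
    intro h0
    have hz : ∀ j, u j = 0 := fun j => by
      have := hprop i j
      rw [h0, zero_mul] at this
      exact (mul_eq_zero.1 this.symm).resolve_right hi
    exact not_isUnit_zero (hu.2 0 fun j => by rw [hz j])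
  obtain ⟨h, hh⟩ : u i ∣ m i := by
    refine dvd_of_forall_dvd_mul hu.2 fun j => ?_
    rw [← hprop i j]; exact dvd_mul_right _ _
  have hmj : ∀ j, m j = h * u j := fun j => by
    apply mul_left_cancel₀ hui
    rw [hprop i j, hh]; ring
  have hh0 : h ≠ 0 := by rintro rfl; exact hi (by rw [hh, mul_zero])
  have hdeg := totalDegree_mul_of_isDomain hui hh0
  rw [← hh, (hmh i).totalDegree hi, (hu.1 i).totalDegree hui] at hdeg
  have hC := totalDegree_eq_zero_iff_eq_C.1 (show h.totalDegree = 0 by omega)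
  refine ⟨h.coeff 0, ?_, ?_, ?_, ?_⟩
  · intro h0; rw [h0, C_0] at hC; exact hh0 hC
  all_goals rw [← hC]
  · simpa [hm] using hmj 0
  · simpa [hm] using hmj 1
  · simpa [hm] using hmj 2

end Syzygies

end ReesCurve

namespace ReesCurve

/-! ### Resultants of pencils of polynomials. -/

section Resultant

theorem resultant_mul_right_of_natDegree_le {R : Type*} [CommRing R] (f g₁ g₂ : Polynomial R)
    {m n₁ n₂ : ℕ} (hf : f.natDegree ≤ m) (h₁ : g₁.natDegree ≤ n₁) (h₂ : g₂.natDegree ≤ n₂) :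
    Polynomial.resultant f (g₁ * g₂) m (n₁ + n₂)
      = Polynomial.resultant f g₁ m n₁ * Polynomial.resultant f g₂ m n₂ := by
  obtain ⟨a, rfl⟩ := Nat.exists_eq_add_of_le h₁
  obtain ⟨b, rfl⟩ := Nat.exists_eq_add_of_le h₂
  rw [show g₁.natDegree + a + (g₂.natDegree + b) = g₁.natDegree + g₂.natDegree + (a + b) by ring,
    Polynomial.resultant_add_right_deg _ _ _ _ _ Polynomial.natDegree_mul_le,
    Polynomial.resultant_add_right_deg _ _ _ _ _ le_rfl,
    Polynomial.resultant_add_right_deg _ _ _ _ _ le_rfl,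
    Polynomial.resultant_mul_right _ _ _ _ hf]
  ring

theorem resultant_ne_zero_of_isCoprime {K : Type*} [Field K] {f g : Polynomial K}
    (hf : f ≠ 0) (h : IsCoprime f g) {n : ℕ} (hn : g.natDegree ≤ n) :
    Polynomial.resultant f g f.natDegree n ≠ 0 := by
  obtain ⟨a, rfl⟩ := Nat.exists_eq_add_of_le hn
  rw [Polynomial.resultant_add_right_deg _ _ _ _ _ le_rfl]
  exact mul_ne_zero (pow_ne_zero _ (by simpa using hf)) (Polynomial.resultant_ne_zero _ _ h)

/-- If `f, l` define a pencil `f + t l` and `h, q` a pencil `h + t q`, the order at `t = 0` of the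
resultant of the pencils is at most `deg f = 2`, provided that `q f - l h = g w` with `g ∣ f` and
that `f` is coprime to `l` and `w`. -/
theorem not_X_pow_three_dvd_resultant {K : Type*} [Field K] {f l q h g g' w : Polynomial K} {N : ℕ}
    (hf : f.natDegree = 2) (hl : l.natDegree ≤ 2) (hq : q.natDegree ≤ N) (hh : h.natDegree ≤ N)
    (hfg : f = g * g') (hw : q * f - l * h = g * w) (hfl : IsCoprime f l) (hfw : IsCoprime f w) :
    ¬ (Polynomial.X ^ 3 : Polynomial K) ∣ Polynomial.resultant
      (Polynomial.C Polynomial.X * l.map Polynomial.C + f.map Polynomial.C)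
      (Polynomial.C Polynomial.X * q.map Polynomial.C + h.map Polynomial.C) 2 N := by
  intro hdvd
  have hf0 : f ≠ 0 := by rintro rfl; simp at hf
  have hg0 : g ≠ 0 := by rintro rfl; simp [hfg] at hf0
  have hg'0 : g' ≠ 0 := by rintro rfl; simp [hfg] at hf0
  set F := Polynomial.C Polynomial.X * l.map Polynomial.C + f.map Polynomial.C with hF
  set H := Polynomial.C Polynomial.X * q.map Polynomial.C + h.map Polynomial.C with hH
  have hdeg : g.natDegree + g'.natDegree = 2 := by
    rw [← hf, hfg, Polynomial.natDegree_mul hg0 hg'0]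
  have hmap : ∀ p : Polynomial K, (p.map (Polynomial.C : K →+* Polynomial K)).natDegree
      = p.natDegree := fun p => Polynomial.natDegree_map_eq_of_injective Polynomial.C_injective p
  have hpencil : ∀ (p p' : Polynomial K) (n : ℕ), p.natDegree ≤ n → p'.natDegree ≤ n →
      (Polynomial.C (Polynomial.X : Polynomial K) * p.map Polynomial.C
        + p'.map Polynomial.C).natDegree ≤ n := by
    intro p p' n hp hp'
    refine (Polynomial.natDegree_add_le _ _).trans (max_le ?_ ((hmap _).le.trans hp'))
    exact (Polynomial.natDegree_C_mul_le _ _).trans ((hmap _).le.trans hp)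
  have hFd : F.natDegree ≤ 2 := hpencil _ _ _ hl hf.le
  have hHd : H.natDegree ≤ N := hpencil _ _ _ hq hh
  have hwd : g.natDegree + w.natDegree ≤ N + 2 := by
    by_cases hw0 : w = 0
    · subst hw0; simp; omega
    rw [← Polynomial.natDegree_mul hg0 hw0, ← hw]
    refine (Polynomial.natDegree_sub_le _ _).trans (max_le ?_ ?_)
    · exact Polynomial.natDegree_mul_le.trans (by omega)
    · exact Polynomial.natDegree_mul_le.trans (by omega)
  set ρ := Polynomial.resultant F (l.map Polynomial.C) 2 2 with hρ
  -- Modulo F, the product H l is -g w; the sign disappears because F has even formal degree 2.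
  have e1 : Polynomial.resultant F H 2 N * ρ
      = Polynomial.resultant F (g.map Polynomial.C) 2 g.natDegree
        * Polynomial.resultant F (w.map Polynomial.C) 2 (N + 2 - g.natDegree) := by
    rw [hρ, ← resultant_mul_right_of_natDegree_le _ _ _ hFd hHd ((hmap _).le.trans hl),
      ← resultant_mul_right_of_natDegree_le _ _ _ hFd (hmap _).le
        ((hmap _).le.trans (by omega : w.natDegree ≤ N + 2 - g.natDegree)),
      show g.natDegree + (N + 2 - g.natDegree) = N + 2 by omega]
    have : H * l.map Polynomial.C = Polynomial.C (-1) * (g.map Polynomial.C * w.map Polynomial.C)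
        + F * q.map Polynomial.C := by
      rw [← Polynomial.map_mul, ← hw, hF, hH]
      simp
      ring
    rw [this, Polynomial.resultant_add_mul_right _ _ _ _ _ (by rw [hmap]; omega) hFd,
      Polynomial.resultant_C_mul_right]
    ring
  -- Here g g' = f, and f is -t l modulo F, with t the pencil parameter; this produces the factor
  -- t².
  have e2 : Polynomial.resultant F (g.map Polynomial.C) 2 g.natDegree
      * Polynomial.resultant F (g'.map Polynomial.C) 2 g'.natDegree = Polynomial.X ^ 2 * ρ := by
    rw [← resultant_mul_right_of_natDegree_le _ _ _ hFd (hmap _).le (hmap _).le, hdeg,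
      ← Polynomial.map_mul, ← hfg]
    have : f.map Polynomial.C = Polynomial.C (-Polynomial.X) * l.map Polynomial.C + F * 1 := by
      rw [hF]; simp; ring
    rw [this, Polynomial.resultant_add_mul_right _ _ _ _ _ (by simp) hFd,
      Polynomial.resultant_C_mul_right]
    ring
  have hF0 : F.map (Polynomial.evalRingHom (0 : K)) = f := by
    rw [hF]; simp [Polynomial.map_map]
    rw [show (Polynomial.evalRingHom (0 : K)).comp Polynomial.C = RingHom.id K by ext; simp,
      Polynomial.map_id]
  have hev : ∀ (p : Polynomial K) (n : ℕ), (Polynomial.resultant F (p.map Polynomial.C) 2 n).eval 0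
      = Polynomial.resultant f p 2 n := by
    intro p n
    have := Polynomial.resultant_map_map F (p.map Polynomial.C) 2 n (Polynomial.evalRingHom (0 : K))
    rw [hF0, Polynomial.map_map,
      show (Polynomial.evalRingHom (0 : K)).comp Polynomial.C = RingHom.id K by ext; simp,
      Polynomial.map_id] at this
    exact this.symm
  have hρ0 : ρ ≠ 0 := by
    intro h0
    have h1 := hev l 2
    rw [← hρ, h0, Polynomial.eval_zero, ← hf] at h1
    exact resultant_ne_zero_of_isCoprime hf0 hfl (hl.trans hf.ge) h1.symm
  set ω := Polynomial.resultant F (w.map Polynomial.C) 2 (N + 2 - g.natDegree) with hω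
  -- After cancelling ρ, the resultant divides t² ω, and ω at t = 0 is the resultant of f and w,
  -- which is nonzero.
  have e3 : Polynomial.resultant F H 2 N
      * Polynomial.resultant F (g'.map Polynomial.C) 2 g'.natDegree = Polynomial.X ^ 2 * ω := by
    apply mul_right_cancel₀ hρ0
    linear_combination Polynomial.resultant F (g'.map Polynomial.C) 2 g'.natDegree * e1 + ω * e2
  have h3 : (Polynomial.X ^ 2 * Polynomial.X : Polynomial K) ∣ Polynomial.X ^ 2 * ω := by
    rw [← e3, ← pow_succ]; exact hdvd.mul_right _
  have h4 := (mul_dvd_mul_iff_left (pow_ne_zero 2 Polynomial.X_ne_zero)).1 h3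
  rw [Polynomial.X_dvd_iff, Polynomial.coeff_zero_eq_eval_zero, hω, hev, ← hf] at h4
  exact resultant_ne_zero_of_isCoprime hf0 hfw (by omega) h4

end Resultant

/-! ### Membership in the Rees ideal tested at points. -/

section Evaluation

variable {K : Type*} [Field K] {u : Fin 3 → PolyT K}

/-- Evaluation of a polynomial in `𝕂[T,X]` at a point `T = r`, `X = x`. -/
noncomputable def evalTX (x : Fin 3 → K) (r : Fin 2 → K) : PolyTX K →+* K :=
  eval₂Hom (eval x) r

@[simp] theorem evalTX_C (x : Fin 3 → K) (r : Fin 2 → K) (p : PolyX K) :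
    evalTX x r (C p) = eval x p := by simp [evalTX]

@[simp] theorem evalTX_inclT (x : Fin 3 → K) (r : Fin 2 → K) (p : PolyT K) :
    evalTX x r (inclT p) = eval r p := by
  simp only [evalTX, inclT, coe_eval₂Hom, eval₂_map]
  rw [show (eval x).comp C = RingHom.id K by ext; simp]
  rfl

@[simp] theorem evalTX_varX (x : Fin 3 → K) (r : Fin 2 → K) (i : Fin 3) :
    evalTX x r (varX i) = x i := by simp [varX]

@[simp] theorem evalTX_varT (x : Fin 3 → K) (r : Fin 2 → K) (i : Fin 2) :
    evalTX x r (varT i) = r i := by simp [varT, evalTX]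

@[simp] theorem evalTX_syzForm (x : Fin 3 → K) (r : Fin 2 → K) (a : Fin 3 → PolyT K) :
    evalTX x r (syzForm a) = eval r (a 0) * x 0 + eval r (a 1) * x 1 + eval r (a 2) * x 2 := by
  simp [syzForm, Fin.sum_univ_three]

theorem eval_eval_reesMap (r : Fin 2 → K) (z : K) (G : PolyTX K) :
    ((reesMap u G).map (eval r)).eval z = evalTX (fun i => z * eval r (u i)) r G := by
  have : ((Polynomial.evalRingHom z).comp (Polynomial.mapRingHom (eval r))).comp (reesMap u)
      = evalTX (fun i => z * eval r (u i)) r := by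
    apply MvPolynomial.ringHom_ext
    · intro p
      refine RingHom.congr_fun (show (((Polynomial.evalRingHom z).comp
        (Polynomial.mapRingHom (eval r))).comp (reesMap u)).comp C
          = (evalTX (fun i => z * eval r (u i)) r).comp C from ?_) p
      apply MvPolynomial.ringHom_ext
      · intro a; simp [reesMap]
      · intro i; simpa [reesMap] using mul_comm _ _
    · intro i
      have := evalTX_varT (fun i => z * eval r (u i)) r i
      simp only [varT] at this
      simp [reesMap, this]
  exact RingHom.congr_fun this G

theorem evalTX_eq_zero_of_mem {G : PolyTX K} (hG : G ∈ reesIdeal u) (r : Fin 2 → K) (z : K) :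
    evalTX (fun i => z * eval r (u i)) r G = 0 := by
  rw [← eval_eval_reesMap, show reesMap u G = 0 from hG]; simp

/-- Over an infinite field a polynomial vanishing off the zero set of `h` is killed by `h`, hence
zero. The freedom in `h` allows restriction to an affine chart. -/
theorem mem_reesIdeal_of_evalTX [Infinite K] {G : PolyTX K} {h : PolyT K} (hh : h ≠ 0)
    (H : ∀ (r : Fin 2 → K) (z : K), eval r h ≠ 0 →
      evalTX (fun i => z * eval r (u i)) r G = 0) : G ∈ reesIdeal u := by
  change reesMap u G = 0
  ext1 n
  rw [Polynomial.coeff_zero]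
  apply (mul_eq_zero.1 _).resolve_right hh
  apply MvPolynomial.funext
  intro r
  by_cases hr : eval r h = 0
  · simp [hr]
  have h1 : (reesMap u G).map (eval r) = 0 := by
    apply Polynomial.funext
    intro z
    rw [eval_eval_reesMap, H r z hr, Polynomial.eval_zero]
  have h2 := congrArg (fun p => Polynomial.coeff p n) h1
  simp only [Polynomial.coeff_map, Polynomial.coeff_zero] at h2
  simp [h2]

theorem eval_aeval {σ τ : Type*} (u : σ → MvPolynomial τ K) (r : τ → K) (G : MvPolynomial σ K) :
    eval r (aeval u G) = eval (fun i => eval r (u i)) G := by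
  have : (eval r).comp (aeval u : MvPolynomial σ K →ₐ[K] MvPolynomial τ K).toRingHom
      = eval (fun i => eval r (u i)) := by
    apply MvPolynomial.ringHom_ext
    · intro a; simp
    · intro i; simp
  exact RingHom.congr_fun this G

theorem aeval_eq_zero_of_C_mem_reesIdeal [Infinite K] {G : PolyX K} (hG : C G ∈ reesIdeal u) :
    aeval u G = 0 := by
  apply MvPolynomial.funext
  intro r
  have := evalTX_eq_zero_of_mem hG r 1
  rw [eval_aeval, map_zero]
  simpa using this

end Evaluation

end ReesCurve

namespace ReesCurve

/-! ### Affine charts of the projective line. -/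

section Dehomogenization

variable {K : Type*} [Field K]

/-- The substitution `T₀ ↦ z`, `T₁ ↦ c z + 1`. -/
noncomputable def dehom (c : K) : PolyT K →ₐ[K] Polynomial K :=
  aeval ![Polynomial.X, Polynomial.C c * Polynomial.X + 1]

theorem eval_dehom (c z : K) (p : PolyT K) :
    (dehom c p).eval z = eval ![z, c * z + 1] p := by
  have : (Polynomial.evalRingHom z).comp (dehom c).toRingHom = eval ![z, c * z + 1] := by
    apply MvPolynomial.ringHom_ext
    · intro a; simp [dehom]
    · intro i; fin_cases i <;> simp [dehom]
  exact RingHom.congr_fun this p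

theorem natDegree_dehom_le (c : K) {p : PolyT K} {n : ℕ} (hp : p.IsHomogeneous n) :
    (dehom c p).natDegree ≤ n := by
  rw [IsHomogeneous.eq_sum_binary hp, map_sum]
  refine Polynomial.natDegree_sum_le_of_forall_le _ _ fun i hi => ?_
  have hi' : i ≤ n := by simpa [Nat.lt_succ_iff] using hi
  have h1 : (Polynomial.C c * Polynomial.X + 1 : Polynomial K).natDegree ≤ 1 := by
    simpa using Polynomial.natDegree_linear_le (a := c) (b := 1)
  simp only [dehom, map_mul, map_pow, aeval_X, Matrix.cons_val, algHom_C,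
    ← Polynomial.C_eq_algebraMap]
  refine (Polynomial.natDegree_C_mul_le _ _).trans ?_
  refine Polynomial.natDegree_mul_le.trans ?_
  have h2 := Polynomial.natDegree_pow_le_of_le (n - i) h1
  have h3 : (Polynomial.X ^ i : Polynomial K).natDegree ≤ i := by simp
  omega

/-- The chart omits only the point (1 : c), so the coefficient in the formal degree is the value
there. Choosing `c` off the zeros of a form keeps its degree from dropping. -/
theorem coeff_dehom (c : K) {p : PolyT K} {n : ℕ} (hp : p.IsHomogeneous n) :
    (dehom c p).coeff n = eval ![1, c] p := by
  rw [IsHomogeneous.eq_sum_binary hp, map_sum, map_sum, Polynomial.finsetSum_coeff]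
  refine Finset.sum_congr rfl fun i hi => ?_
  have hi' : i ≤ n := by simpa [Nat.lt_succ_iff] using hi
  have h1 : (Polynomial.C c * Polynomial.X + 1 : Polynomial K).natDegree ≤ 1 := by
    simpa using Polynomial.natDegree_linear_le (a := c) (b := 1)
  simp only [dehom, map_mul, map_pow, aeval_X, Matrix.cons_val, algHom_C,
    ← Polynomial.C_eq_algebraMap, eval_C, eval_X, Polynomial.coeff_C_mul]
  obtain ⟨j, rfl⟩ := Nat.exists_eq_add_of_le hi'
  rw [Nat.add_sub_cancel_left, add_comm i j, Polynomial.coeff_X_pow_mul]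
  have := Polynomial.coeff_pow_of_natDegree_le (m := j) h1
  rw [mul_one] at this
  simp [this, Polynomial.coeff_one]

theorem exists_eval_one_ne_zero [Infinite K] {p : PolyT K} (hp0 : p ≠ 0) {n : ℕ}
    (hp : p.IsHomogeneous n) : ∃ c, eval ![1, c] p ≠ 0 := by
  by_contra! h
  -- The points (1, c) reach, after scaling, everything off `r 0 = 0`; the factor `X 0` covers that
  -- line.
  have : X 0 * p = 0 := by
    apply MvPolynomial.funext
    intro r
    by_cases hr : r 0 = 0
    · simp [hr]
    have h1 := eval_mul_of_isHomogeneous hp (r 0) ![1, r 1 / r 0]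
    rw [h, mul_zero, show (fun i => r 0 * ![1, r 1 / r 0] i) = r by
      ext i; fin_cases i <;> simp; field_simp] at h1
    simp [h1]
  exact hp0 ((mul_eq_zero.1 this).resolve_left (X_ne_zero _))

end Dehomogenization

/-! ### Multiplicity at (0:0:1) and the vanishing of `P 2`. -/

section Multiplicity

variable {K : Type*} [Field K]

/-- After translation the line (t, st, 1) becomes (t, st, 0): monomials containing X₂ die and the
others become multiples of t to their degree. -/
theorem X_pow_dvd_of_le_multAt {E : PolyX K} {n : ℕ} (h : n ≤ multAt E ![0, 0, 1]) (s : K) :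
    (Polynomial.X ^ n : Polynomial K) ∣
      aeval ![Polynomial.X, Polynomial.C s * Polynomial.X, 1] E := by
  set E' : PolyX K := aeval (fun i => X i + C ((![0, 0, 1] : Fin 3 → K) i)) E with hE'
  have h1 : aeval ![Polynomial.X, Polynomial.C s * Polynomial.X, (1 : Polynomial K)] E
      = aeval ![Polynomial.X, Polynomial.C s * Polynomial.X, (0 : Polynomial K)] E' := by
    rw [hE', ← AlgHom.comp_apply]
    congr 1
    apply MvPolynomial.algHom_ext
    intro i; fin_cases i <;> simp
  rw [h1, aeval_def, eval₂_eq']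
  refine Finset.dvd_sum fun d hd => Dvd.dvd.mul_left ?_ _
  have hdeg : n ≤ d.degree := by
    have : multAt E ![0, 0, 1] ≤ d.degree :=
      MvPowerSeries.order_le (d := d) (by rw [MvPolynomial.coeff_coe]; exact mem_support_iff.1 hd)
    exact_mod_cast h.trans this
  rw [Finsupp.degree_eq_sum, Fin.sum_univ_three] at hdeg
  rw [Fin.prod_univ_three]
  simp only [Matrix.cons_val]
  by_cases h2 : d 2 = 0
  · refine Dvd.dvd.mul_right ?_ _
    rw [mul_pow, mul_left_comm, ← pow_add]
    exact (pow_dvd_pow _ (by omega)).mul_left _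
  · simp [h2]

theorem exists_forall_add_mul_ne_zero [Infinite K] {ι : Type*} (S : Finset ι) (a b : ι → K)
    (h : ∀ z ∈ S, a z ≠ 0 ∨ b z ≠ 0) : ∃ s, ∀ z ∈ S, a z + s * b z ≠ 0 := by
  have hp : ∏ z ∈ S, (Polynomial.C (a z) + Polynomial.X * Polynomial.C (b z)) ≠ 0 := by
    rw [Finset.prod_ne_zero_iff]
    intro z hz h0
    have h1 := congrArg (fun p => Polynomial.coeff p 0) h0
    have h2 := congrArg (fun p => Polynomial.coeff p 1) h0
    simp [Polynomial.coeff_C] at h1 h2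
    rcases h z hz with h | h
    · exact h h1
    · exact h h2
  by_contra! H
  apply hp
  apply Polynomial.funext
  intro s
  obtain ⟨z, hz, h0⟩ := H s
  rw [Polynomial.eval_prod, Polynomial.eval_zero]
  exact Finset.prod_eq_zero hz (by rw [← h0]; simp; ring)

theorem isCoprime_of_forall_eval_ne_zero [IsAlgClosed K] [DecidableEq K] {p q : Polynomial K} (hp : p ≠ 0)
    (h : ∀ z ∈ p.roots.toFinset, q.eval z ≠ 0) : IsCoprime p q := by
  rw [Polynomial.isCoprime_iff_aeval_ne_zero_of_isAlgClosed K K]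
  intro z
  by_cases hz : p.eval z = 0
  · exact Or.inr (by simpa using h z (by simpa [hp] using hz))
  · exact Or.inl (by simpa using hz)

end Multiplicity

end ReesCurve

namespace ReesCurve

section Multiplicity

variable {K : Type*} [Field K]

/-- The polynomial `∑ aᵢ Xᵢ` in one variable over `𝕂[X]`. -/
noncomputable def polyForm (a : Fin 3 → Polynomial K) : Polynomial (PolyX K) :=
  ∑ i, Polynomial.C (X i) * (a i).map C

theorem natDegree_polyForm_le {a : Fin 3 → Polynomial K} {n : ℕ} (h : ∀ i, (a i).natDegree ≤ n) :
    (polyForm a).natDegree ≤ n :=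
  Polynomial.natDegree_sum_le_of_forall_le _ _ fun i _ =>
    (Polynomial.natDegree_C_mul_le _ _).trans (Polynomial.natDegree_map_le.trans (h i))

theorem eval_map_polyForm (x : Fin 3 → K) (z : K) (a : Fin 3 → Polynomial K) :
    ((polyForm a).map (eval x)).eval z
      = (a 0).eval z * x 0 + (a 1).eval z * x 1 + (a 2).eval z * x 2 := by
  have h : (eval x).comp C = RingHom.id K := by ext; simp
  simp [polyForm, Fin.sum_univ_three, Polynomial.map_map, h, Polynomial.map_id]
  ring

theorem map_aeval_polyForm (s : K) (a : Fin 3 → Polynomial K) :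
    (polyForm a).map (aeval ![Polynomial.X, Polynomial.C s * Polynomial.X, (1 : Polynomial K)] :
        PolyX K →ₐ[K] Polynomial K).toRingHom
      = Polynomial.C Polynomial.X * (a 0 + Polynomial.C s * a 1).map Polynomial.C
        + (a 2).map Polynomial.C := by
  have h : ((aeval ![Polynomial.X, Polynomial.C s * Polynomial.X, (1 : Polynomial K)] :
      PolyX K →ₐ[K] Polynomial K) : PolyX K →+* Polynomial K).comp C = Polynomial.C := by
    ext x; simp
  simp [polyForm, Fin.sum_univ_three, Polynomial.map_map, h]
  ring

variable {d : ℕ} {u P Q : Fin 3 → PolyT K}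

/-- The resultant is a combination of the two moving lines, which both vanish at X = z u(T). Only
parameters in the chart need testing. -/
theorem C_resultant_mem_reesIdeal [Infinite K] (hu : IsParametrization d u) {m n : ℕ} (hm : m ≠ 0)
    (hP : ∀ i, (P i).IsHomogeneous m) (hQ : ∀ i, (Q i).IsHomogeneous n)
    (hPs : P ∈ syz u) (hQs : Q ∈ syz u) (c : K) :
    C (Polynomial.resultant (polyForm fun i => dehom c (P i)) (polyForm fun i => dehom c (Q i)) m n)
      ∈ reesIdeal u := by
  rw [mem_syz_iff] at hPs hQs
  obtain ⟨p, q, -, -, h⟩ := Polynomial.exists_mul_add_mul_eq_C_resultant _ _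
    (natDegree_polyForm_le fun i => natDegree_dehom_le c (hP i))
    (natDegree_polyForm_le fun i => natDegree_dehom_le c (hQ i)) (Or.inl hm)
  have hne : (X 1 - C c * X 0 : PolyT K) ≠ 0 := by
    intro h0
    have := congrArg (eval ![0, 1]) h0
    simp at this
  refine mem_reesIdeal_of_evalTX hne fun r z hr => ?_
  have hl : r 1 - c * r 0 ≠ 0 := by simpa using hr
  set l := r 1 - c * r 0 with hl'
  -- A parameter off the omitted point is `l` times a chart point, and `u` scales by `l ^ d`.
  have hr' : (fun i => l * ![r 0 / l, c * (r 0 / l) + 1] i) = r := by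
    ext i
    fin_cases i
    · simp; field_simp
    · simp; field_simp; rw [hl']; ring
  have hx : (fun i => z * eval r (u i))
      = fun i => z * l ^ d * eval ![r 0 / l, c * (r 0 / l) + 1] (u i) := by
    funext i
    have := eval_mul_of_isHomogeneous (hu.1 i) l ![r 0 / l, c * (r 0 / l) + 1]
    rw [hr'] at this
    rw [this]; ring
  rw [evalTX_C, hx]
  have h1 := congrArg (fun G => (G.map (eval fun i =>
    z * l ^ d * eval ![r 0 / l, c * (r 0 / l) + 1] (u i))).eval (r 0 / l)) h
  simp only [Polynomial.map_add, Polynomial.map_mul, Polynomial.eval_add, Polynomial.eval_mul,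
    eval_map_polyForm, Polynomial.map_C, Polynomial.eval_C, eval_dehom] at h1
  rw [← h1]
  have hP0 := congrArg (eval ![r 0 / l, c * (r 0 / l) + 1]) hPs
  have hQ0 := congrArg (eval ![r 0 / l, c * (r 0 / l) + 1]) hQs
  simp only [map_add, map_mul, map_zero] at hP0 hQ0
  set y := ![r 0 / l, c * (r 0 / l) + 1]
  set A := eval fun i => z * l ^ d * eval y (u i)
  linear_combination z * l ^ d * ((p.map A).eval (r 0 / l)) * hP0
    + z * l ^ d * ((q.map A).eval (r 0 / l)) * hQ0

/-- `E` divides the resultant R, so if `P 2` were nonzero, t³ would divide the restriction of R to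
every line (t, st, 1). For general s this contradicts `not_X_pow_three_dvd_resultant`. -/
theorem eq_zero_of_two_lt_multAt [IsAlgClosed K] (hu : IsParametrization d u)
    (hP : ∀ i, (P i).IsHomogeneous 2) (hQ : ∀ i, (Q i).IsHomogeneous (d - 2))
    (hPs : P ∈ syz u) (hQs : Q ∈ syz u) {c : K} (hc : c ≠ 0)
    (h0 : P 1 * Q 2 - P 2 * Q 1 = C c * u 0) (h1 : P 2 * Q 0 - P 0 * Q 2 = C c * u 1)
    (h2 : P 0 * Q 1 - P 1 * Q 0 = C c * u 2)
    {E : PolyX K} (hE : IsImplicitEquation u E) (hsing : 2 < multAt E ![0, 0, 1]) : P 2 = 0 := by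
  classical
  by_contra hP2
  have hinf : Infinite K := IsAlgClosed.instInfinite
  obtain ⟨b, hb⟩ := exists_eval_one_ne_zero hP2 (hP 2)
  set f := dehom b (P 2) with hf
  have hfdeg : f.natDegree = 2 := by
    refine le_antisymm (natDegree_dehom_le b (hP 2)) (Polynomial.le_natDegree_of_ne_zero ?_)
    rwa [hf, coeff_dehom b (hP 2)]
  have hf0 : f ≠ 0 := by intro h; simp [h] at hfdeg
  have hpt : ∀ z : K, (![z, b * z + 1] : Fin 2 → K) ≠ 0 := by
    intro z h
    have e0 := congrFun h 0
    have e1 := congrFun h 1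
    simp at e0 e1
    simp [e0] at e1
  have hsyz : P 0 * u 0 + P 1 * u 1 + P 2 * u 2 = 0 := mem_syz_iff.1 hPs
  have hu01 : dehom b (u 0) ≠ 0 ∨ dehom b (u 1) ≠ 0 := by
    by_contra! h
    have h3 := congrArg (dehom b) hsyz
    simp only [map_add, map_mul, h.1, h.2, mul_zero, zero_add, map_zero] at h3
    have h4 := (mul_eq_zero.1 h3).resolve_left hf0
    obtain ⟨i, hi⟩ := exists_eval_ne_zero_of_isParametrization hu (hpt 0)
    apply hi
    rw [← eval_dehom]
    match i with
    | 0 => rw [h.1, Polynomial.eval_zero]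
    | 1 => rw [h.2, Polynomial.eval_zero]
    | 2 => rw [h4, Polynomial.eval_zero]
  have hgne : EuclideanDomain.gcd (dehom b (u 0)) (dehom b (u 1)) ≠ 0 := by
    rw [Ne, EuclideanDomain.gcd_eq_zero_iff]
    tauto
  obtain ⟨g, a₀, a₁, hg0, hg1, hcop⟩ : ∃ g a₀ a₁, dehom b (u 0) = g * a₀ ∧ dehom b (u 1) = g * a₁ ∧
      IsCoprime a₀ a₁ := by
    obtain ⟨a₀, ha₀⟩ := EuclideanDomain.gcd_dvd_left (dehom b (u 0)) (dehom b (u 1))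
    obtain ⟨a₁, ha₁⟩ := EuclideanDomain.gcd_dvd_right (dehom b (u 0)) (dehom b (u 1))
    refine ⟨_, a₀, a₁, ha₀, ha₁, ?_⟩
    refine ⟨EuclideanDomain.gcdA (dehom b (u 0)) (dehom b (u 1)),
      EuclideanDomain.gcdB (dehom b (u 0)) (dehom b (u 1)), ?_⟩
    apply mul_left_cancel₀ hgne
    have := EuclideanDomain.gcd_eq_gcd_ab (dehom b (u 0)) (dehom b (u 1))
    linear_combination -this - EuclideanDomain.gcdA (dehom b (u 0)) (dehom b (u 1)) * ha₀
      - EuclideanDomain.gcdB (dehom b (u 0)) (dehom b (u 1)) * ha₁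
  have hgu2 : IsCoprime g (dehom b (u 2)) := by
    rw [Polynomial.isCoprime_iff_aeval_ne_zero_of_isAlgClosed K K]
    intro z
    by_contra! h
    simp only [Polynomial.coe_aeval_eq_eval] at h
    obtain ⟨i, hi⟩ := exists_eval_ne_zero_of_isParametrization hu (hpt z)
    apply hi
    rw [← eval_dehom]
    match i with
    | 0 => rw [hg0, Polynomial.eval_mul, h.1, zero_mul]
    | 1 => rw [hg1, Polynomial.eval_mul, h.1, zero_mul]
    | 2 => exact h.2
  -- The syzygy P shows that g divides f times the dehomogenized u₂, and g is coprime to the latter.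
  obtain ⟨g', hg'⟩ : g ∣ f := by
    apply hgu2.dvd_of_dvd_mul_right
    have h3 := congrArg (dehom b) hsyz
    simp only [map_add, map_mul, map_zero, hg0, hg1] at h3
    exact ⟨-(dehom b (P 0) * a₀ + dehom b (P 1) * a₁), by rw [hf]; linear_combination h3⟩
  have hPne : ∀ z, f.eval z = 0 → (dehom b (P 0)).eval z ≠ 0 ∨ (dehom b (P 1)).eval z ≠ 0 := by
    intro z hz
    by_contra! h
    obtain ⟨i, hi⟩ := exists_eval_ne_zero_of_isParametrization hu (hpt z)
    simp only [hf, eval_dehom] at hz h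
    have hz0 := congrArg (eval ![z, b * z + 1]) h0
    have hz1 := congrArg (eval ![z, b * z + 1]) h1
    have hz2 := congrArg (eval ![z, b * z + 1]) h2
    simp only [map_sub, map_mul, h.1, h.2, hz, eval_C, zero_mul, sub_zero] at hz0 hz1 hz2
    apply hi
    match i with
    | 0 => exact (mul_eq_zero.1 hz0.symm).resolve_left hc
    | 1 => exact (mul_eq_zero.1 hz1.symm).resolve_left hc
    | 2 => exact (mul_eq_zero.1 hz2.symm).resolve_left hc
  have hane : ∀ z, a₁.eval z ≠ 0 ∨ (-a₀).eval z ≠ 0 := by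
    intro z
    have := (Polynomial.isCoprime_iff_aeval_ne_zero_of_isAlgClosed K K _ _).1 hcop z
    simp only [Polynomial.coe_aeval_eq_eval] at this
    rw [Polynomial.eval_neg, neg_ne_zero]
    exact this.symm
  -- One slope s serves two purposes at the roots of f: the tag `true` keeps P₀ + s P₁ nonzero, the
  -- tag `false` keeps a₁ - s a₀ nonzero.
  obtain ⟨s, hs⟩ := exists_forall_add_mul_ne_zero (Finset.univ ×ˢ f.roots.toFinset : Finset (Bool × K))
    (fun y => cond y.1 ((dehom b (P 0)).eval y.2) (a₁.eval y.2))
    (fun y => cond y.1 ((dehom b (P 1)).eval y.2) ((-a₀).eval y.2)) (by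
      rintro ⟨y, z⟩ hy
      have hz : f.eval z = 0 := by simpa [hf0] using hy
      cases y
      · exact hane z
      · exact hPne z hz)
  have hR := C_resultant_mem_reesIdeal hu two_ne_zero hP hQ hPs hQs b
  set R := Polynomial.resultant (polyForm fun i => dehom b (P i)) (polyForm fun i => dehom b (Q i))
    2 (d - 2) with hRdef
  have hER : E ∣ R := by
    rw [← Ideal.mem_span_singleton, hE.2]; exact hR
  have hX := (X_pow_dvd_of_le_multAt (n := 3) (E := E) (by
    have h3 := Order.add_one_le_of_lt hsing
    rw [show (2 : ℕ∞) + 1 = ((3 : ℕ) : ℕ∞) by norm_num] at h3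
    exact h3) s).trans (map_dvd _ hER)
  have hRmap := Polynomial.resultant_map_map (polyForm fun i => dehom b (P i))
    (polyForm fun i => dehom b (Q i)) 2 (d - 2)
    (aeval ![Polynomial.X, Polynomial.C s * Polynomial.X, (1 : Polynomial K)] :
        PolyX K →ₐ[K] Polynomial K).toRingHom
  rw [map_aeval_polyForm, map_aeval_polyForm, ← hRdef] at hRmap
  have hlin : ∀ (p q : PolyT K) (n : ℕ), p.IsHomogeneous n → q.IsHomogeneous n →
      (dehom b p + Polynomial.C s * dehom b q).natDegree ≤ n := fun p q n hp hq =>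
    (Polynomial.natDegree_add_le _ _).trans (max_le (natDegree_dehom_le b hp)
      ((Polynomial.natDegree_C_mul_le _ _).trans (natDegree_dehom_le b hq)))
  refine not_X_pow_three_dvd_resultant (f := f) (g := g) (g' := g')
    (w := Polynomial.C c * (a₁ - Polynomial.C s * a₀)) hfdeg (hlin _ _ 2 (hP 0) (hP 1))
    (hlin _ _ (d - 2) (hQ 0) (hQ 1)) (natDegree_dehom_le b (hQ 2)) hg' ?_ ?_ ?_
    (hRmap ▸ hX)
  · have e0 := congrArg (dehom b) h0
    have e1 := congrArg (dehom b) h1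
    have hC : dehom b (C c) = Polynomial.C c := by
      simp [dehom, Polynomial.C_eq_algebraMap]
    simp only [map_sub, map_mul, hC, hg0, hg1] at e0 e1
    rw [hf]
    linear_combination e1 - Polynomial.C s * e0
  · refine isCoprime_of_forall_eval_ne_zero hf0 fun z hz => ?_
    simpa using hs (true, z) (by simpa using hz)
  · refine isCoprime_of_forall_eval_ne_zero hf0 fun z hz => ?_
    have := hs (false, z) (by simpa using hz)
    simpa [hc, sub_eq_add_neg] using this

end Multiplicity

end ReesCurve

namespace ReesCurve

/-! ### Base-point-free pencils of binary quadratic forms. -/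

section Pencil

variable {K : Type*} [Field K]

theorem isHomogeneous_right_of_mul {σ : Type*} {f g : MvPolynomial σ K} {m n : ℕ}
    (hf : f.IsHomogeneous m) (hfg : (f * g).IsHomogeneous (m + n)) (h0 : f * g ≠ 0) :
    g.IsHomogeneous n := by
  have hg := isHomogeneous_left_of_mul (mul_comm f g ▸ hfg) (mul_comm f g ▸ h0)
  have h1 := totalDegree_mul_of_isDomain (left_ne_zero_of_mul h0) (right_ne_zero_of_mul h0)
  rw [hfg.totalDegree h0, hf.totalDegree (left_ne_zero_of_mul h0)] at h1
  rwa [show g.totalDegree = n by omega] at hg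

theorem exists_smul_eq_of_mul_eq_mul {x y : Fin 2 → K} (hx : x ≠ 0) (hy : y ≠ 0)
    (h : x 0 * y 1 = x 1 * y 0) : ∃ c : K, c ≠ 0 ∧ ∀ i, y i = c * x i := by
  have key : ∃ c : K, ∀ i, y i = c * x i := by
    by_cases h0 : x 0 = 0
    · have h1 : x 1 ≠ 0 := by
        intro h1; apply hx; ext i; fin_cases i <;> simp [h0, h1]
      refine ⟨y 1 / x 1, fun i => ?_⟩
      match i with
      | 0 => rw [h0, zero_mul] at h; rw [h0, mul_zero]; exact (mul_eq_zero.1 h.symm).resolve_left h1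
      | 1 => field_simp
    · refine ⟨y 0 / x 0, fun i => ?_⟩
      match i with
      | 0 => field_simp
      | 1 => field_simp; linear_combination h
  obtain ⟨c, hc⟩ := key
  refine ⟨c, ?_, hc⟩
  rintro rfl
  apply hy; ext i; simp [hc]

variable [IsAlgClosed K] {p0 p1 : PolyT K}

/-- Surjectivity of p on the projective line: the quadratic form x₀ p¹ - x₁ p⁰ has a zero over an
algebraically closed field. -/
theorem exists_eval_pencil_eq_smul (h0 : p0.IsHomogeneous 2) (h1 : p1.IsHomogeneous 2)
    (hp : ∀ r : Fin 2 → K, r ≠ 0 → (![eval r p0, eval r p1] : Fin 2 → K) ≠ 0)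
    {x : Fin 2 → K} (hx : x ≠ 0) :
    ∃ (r : Fin 2 → K) (c : K), r ≠ 0 ∧ c ≠ 0 ∧ eval r p0 = c * x 0 ∧ eval r p1 = c * x 1 := by
  obtain ⟨r, hr, hr0⟩ := exists_eval_eq_zero_of_isHomogeneous
    ((h1.C_mul (x 0)).sub (h0.C_mul (x 1))) two_pos
  obtain ⟨c, hc, h⟩ := exists_smul_eq_of_mul_eq_mul hx (hp r hr) (by
    simpa [sub_eq_zero] using hr0)
  exact ⟨r, c, hr, hc, by simpa using h 0, by simpa using h 1⟩

theorem eq_zero_of_aeval_pencil_eq_zero (h0 : p0.IsHomogeneous 2) (h1 : p1.IsHomogeneous 2)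
    (hp : ∀ r : Fin 2 → K, r ≠ 0 → (![eval r p0, eval r p1] : Fin 2 → K) ≠ 0)
    {G : PolyT K} {n : ℕ} (hG : G.IsHomogeneous n)
    (h : aeval ![p0, p1] G = 0) : G = 0 := by
  have hinf : Infinite K := IsAlgClosed.instInfinite
  have hne : ∀ x : Fin 2 → K, x ≠ 0 → eval x G = 0 := by
    intro x hx
    obtain ⟨r, c, -, hc, e0, e1⟩ := exists_eval_pencil_eq_smul h0 h1 hp hx
    have h2 := congrArg (eval r) h
    rw [eval_aeval, map_zero, show (fun i => eval r ((![p0, p1] : Fin 2 → PolyT K) i))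
      = fun i => c * x i by ext i; fin_cases i <;> simp [e0, e1],
      eval_mul_of_isHomogeneous hG] at h2
    exact (mul_eq_zero.1 h2).resolve_left (pow_ne_zero _ hc)
  -- Vanishing is known only away from the origin; the factor `X 0` supplies the origin.
  have : X 0 * G = 0 := by
    apply MvPolynomial.funext
    intro x
    by_cases hx : x = 0
    · simp [hx]
    · simp [hne x hx]
  exact (mul_eq_zero.1 this).resolve_left (X_ne_zero _)

/-- A degree 2 map p has no left inverse (A : B). The proof is a descent: A(p) = T₀ q and B(p) = T₁
q with q of positive odd degree; at a root r of q both A and B vanish at p(r), so they share a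
linear factor that can be cancelled. -/
theorem eq_zero_of_X_mul_aeval_pencil_eq (h0 : p0.IsHomogeneous 2) (h1 : p1.IsHomogeneous 2)
    (hp : ∀ r : Fin 2 → K, r ≠ 0 → (![eval r p0, eval r p1] : Fin 2 → K) ≠ 0)
    {n : ℕ} {A B : PolyT K} (hA : A.IsHomogeneous n)
    (hB : B.IsHomogeneous n)
    (h : X 0 * aeval ![p0, p1] B = X 1 * aeval ![p0, p1] A) : A = 0 ∧ B = 0 := by
  induction n generalizing A B with
  | zero =>
    have hA' := totalDegree_eq_zero_iff_eq_C.1 (Nat.le_zero.1 hA.totalDegree_le)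
    have hB' := totalDegree_eq_zero_iff_eq_C.1 (Nat.le_zero.1 hB.totalDegree_le)
    rw [hA', hB'] at h ⊢
    have e0 := congrArg (eval ![1, 0]) h
    have e1 := congrArg (eval ![0, 1]) h
    simp at e0 e1
    simp [← e1, e0]
  | succ n ih =>
    have hiff : A = 0 ↔ B = 0 := by
      constructor
      · rintro rfl
        rw [map_zero, mul_zero] at h
        exact eq_zero_of_aeval_pencil_eq_zero h0 h1 hp hB
          ((mul_eq_zero.1 h).resolve_left (X_ne_zero _))
      · rintro rfl
        rw [map_zero, mul_zero] at h
        exact eq_zero_of_aeval_pencil_eq_zero h0 h1 hp hA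
          ((mul_eq_zero.1 h.symm).resolve_left (X_ne_zero _))
    by_cases hA0 : A = 0
    · exact ⟨hA0, hiff.1 hA0⟩
    exfalso
    have hB0 : B ≠ 0 := fun h => hA0 (hiff.2 h)
    have hAp : aeval ![p0, p1] A ≠ 0 := fun h =>
      hA0 (eq_zero_of_aeval_pencil_eq_zero h0 h1 hp hA h)
    have hpX : Prime (X 1 : PolyT K) := X_prime
    have hdvd : (X 1 : PolyT K) ∣ aeval ![p0, p1] B := by
      refine (hpX.dvd_or_dvd ⟨_, h⟩).resolve_left ?_
      rintro ⟨q, hq⟩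
      have := congrArg (eval ![1, 0]) hq
      simp at this
    obtain ⟨q, hq⟩ := hdvd
    have hqA : aeval ![p0, p1] A = X 0 * q := by
      apply mul_left_cancel₀ (X_ne_zero (R := K) (1 : Fin 2))
      rw [← h, hq]; ring
    have hAph : (aeval ![p0, p1] A).IsHomogeneous (2 * (n + 1)) := hA.aeval _ (by
      intro i; fin_cases i <;> simpa)
    have hqh : q.IsHomogeneous (2 * n + 1) := by
      refine isHomogeneous_right_of_mul (isHomogeneous_X K 0) ?_ (hqA ▸ hAp)
      rw [← hqA]
      convert hAph using 1
      ring
    obtain ⟨r, hr, hr0⟩ := exists_eval_eq_zero_of_isHomogeneous hqh (by omega)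
    set y : Fin 2 → K := ![eval r p0, eval r p1] with hy
    have hevy : ∀ G : PolyT K, eval y G = eval r (aeval ![p0, p1] G) := by
      intro G
      rw [eval_aeval]
      congr 1
      congr 1
      ext i; fin_cases i <;> simp [hy]
    obtain ⟨A', hA'⟩ := lineThrough_dvd_of_eval_eq_zero hA (hp r hr)
      (show eval y A = 0 by rw [hevy, hqA]; simp [hr0])
    obtain ⟨B', hB'⟩ := lineThrough_dvd_of_eval_eq_zero hB (hp r hr)
      (show eval y B = 0 by rw [hevy, hq]; simp [hr0])
    have hline := lineThrough_isHomogeneous y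
    have hlp : aeval ![p0, p1] (lineThrough y) ≠ 0 := fun h =>
      lineThrough_ne_zero (hp r hr) (eq_zero_of_aeval_pencil_eq_zero h0 h1 hp hline h)
    have hA'h : A'.IsHomogeneous n :=
      isHomogeneous_right_of_mul hline (by rw [← hA', add_comm]; exact hA) (hA' ▸ hA0)
    have hB'h : B'.IsHomogeneous n :=
      isHomogeneous_right_of_mul hline (by rw [← hB', add_comm]; exact hB) (hB' ▸ hB0)
    have := ih hA'h hB'h (by
      apply mul_left_cancel₀ hlp
      rw [mul_left_comm, ← map_mul, ← hB', h, hA', map_mul]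
      ring)
    exact hA0 (by rw [hA', this.1, mul_zero])

end Pencil

/-! ### Degree of the implicit equation in X₂. -/

section LastVariable

variable {K : Type*} [Field K]

/-- `𝕂[X₀,X₁,X₂]` as polynomials in `X₂` over `𝕂[X₀,X₁]`. -/
noncomputable def toPolyX2 : PolyX K ≃ₐ[K] Polynomial (MvPolynomial (Fin 2) K) :=
  (renameEquiv K (finRotate 3)).trans (finSuccEquiv K 2)

theorem toPolyX2_X_zero : toPolyX2 (X 0 : PolyX K) = Polynomial.C (X 0) := by
  have h : finRotate 3 0 = Fin.succ (0 : Fin 2) := rfl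
  simp only [toPolyX2, AlgEquiv.trans_apply, renameEquiv_apply, rename_X]
  rw [h, finSuccEquiv_X_succ]

theorem toPolyX2_X_one : toPolyX2 (X 1 : PolyX K) = Polynomial.C (X 1) := by
  have h : finRotate 3 1 = Fin.succ (1 : Fin 2) := rfl
  simp only [toPolyX2, AlgEquiv.trans_apply, renameEquiv_apply, rename_X]
  rw [h, finSuccEquiv_X_succ]

theorem toPolyX2_X_two : toPolyX2 (X 2 : PolyX K) = Polynomial.X := by
  have h : finRotate 3 2 = 0 := rfl
  simp only [toPolyX2, AlgEquiv.trans_apply, renameEquiv_apply, rename_X]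
  rw [h, finSuccEquiv_X_zero]

theorem eval₂_toPolyX2 {S : Type*} [CommRing S] [Algebra K S] (g : Fin 3 → S) (E : PolyX K) :
    (toPolyX2 E).eval₂ (aeval ![g 0, g 1] : MvPolynomial (Fin 2) K →ₐ[K] S).toRingHom (g 2)
      = aeval g E := by
  have : (Polynomial.eval₂RingHom (aeval ![g 0, g 1] : MvPolynomial (Fin 2) K →ₐ[K] S).toRingHom
      (g 2)).comp (toPolyX2 (K := K)).toAlgHom.toRingHom = (aeval g : PolyX K →ₐ[K] S).toRingHom := by
    apply MvPolynomial.ringHom_ext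
    · intro a
      simp [toPolyX2, finSuccEquiv_apply]
    · intro i
      fin_cases i
      · simp [toPolyX2_X_zero]
      · simp [toPolyX2_X_one]
      · simp [toPolyX2_X_two]
  exact RingHom.congr_fun this E

theorem coeff_toPolyX2_isHomogeneous {E : PolyX K} {i j n : ℕ} (hE : E.IsHomogeneous n)
    (h : i + j = n) : ((toPolyX2 E).coeff i).IsHomogeneous j :=
  (hE.rename_isHomogeneous (f := finRotate 3)).finSuccEquiv_coeff_isHomogeneous i j h

/-- The implicit equation of a properly parametrized curve that passes through `(0 : 0 : 1)` and
meets the lines through this point residually in two points has degree at least two in `X₂`. -/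
theorem two_le_natDegree_toPolyX2 [IsAlgClosed K] {p0 p1 g : PolyT K} {u : Fin 3 → PolyT K}
    (h0 : p0.IsHomogeneous 2) (h1 : p1.IsHomogeneous 2)
    (hp : ∀ r : Fin 2 → K, r ≠ 0 → (![eval r p0, eval r p1] : Fin 2 → K) ≠ 0)
    (hg : g ≠ 0) (hu0 : u 0 = g * p0) (hu1 : u 1 = g * p1) (hproper : IsProper u)
    {E : PolyX K} (hE0 : E ≠ 0) {n : ℕ} (hE : E.IsHomogeneous n) (hEu : aeval u E = 0) :
    2 ≤ (toPolyX2 E).natDegree := by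
  by_contra! hlt
  obtain ⟨e, rfl⟩ : ∃ e, n = e + 1 := by
    refine Nat.exists_eq_succ_of_ne_zero ?_
    rintro rfl
    have hC := totalDegree_eq_zero_iff_eq_C.1 (Nat.le_zero.1 hE.totalDegree_le)
    rw [hC, algHom_C] at hEu
    apply hE0
    rw [hC, C_eq_zero]
    simpa using hEu
  set A' := (toPolyX2 E).coeff 1 with hA'
  set B' := (toPolyX2 E).coeff 0 with hB'
  have hA'h : A'.IsHomogeneous e := coeff_toPolyX2_isHomogeneous hE (add_comm _ _)
  have hB'h : B'.IsHomogeneous (e + 1) := coeff_toPolyX2_isHomogeneous hE (zero_add _)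
  have hform : toPolyX2 E = Polynomial.C A' * Polynomial.X + Polynomial.C B' :=
    Polynomial.eq_X_add_C_of_natDegree_le_one (by omega)
  have hgp : ∀ {G : MvPolynomial (Fin 2) K} {m : ℕ}, G.IsHomogeneous m →
      aeval ![u 0, u 1] G = g ^ m * aeval ![p0, p1] G := by
    intro G m hG
    rw [← aeval_mul_of_isHomogeneous hG]
    congr 2
    ext1 i; fin_cases i <;> simp [hu0, hu1]
  have hrel : aeval ![p0, p1] A' * u 2 = -(g * aeval ![p0, p1] B') := by
    rw [← eval₂_toPolyX2, hform] at hEu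
    simp only [Polynomial.eval₂_add, Polynomial.eval₂_mul, Polynomial.eval₂_C,
      Polynomial.eval₂_X, AlgHom.toRingHom_eq_coe, RingHom.coe_coe, hgp hA'h, hgp hB'h] at hEu
    apply mul_left_cancel₀ (pow_ne_zero e hg)
    linear_combination hEu
  have hA'0 : A' ≠ 0 := by
    intro hz
    rw [hz, map_zero, zero_mul, eq_comm, neg_eq_zero] at hrel
    have hz' := eq_zero_of_aeval_pencil_eq_zero h0 h1 hp hB'h ((mul_eq_zero.1 hrel).resolve_left hg)
    rw [hz, hz'] at hform
    simp at hform
    exact hE0 hform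
  have hA'p : aeval ![p0, p1] A' ≠ 0 := fun h =>
    hA'0 (eq_zero_of_aeval_pencil_eq_zero h0 h1 hp hA'h h)
  obtain ⟨l, A, B, hA, hB, hne, hAB⟩ := hproper
  -- If E = A' X₂ + B', solving for X₂ parametrizes the curve by (x₀ : x₁): g v(p) = A'(p) u.
  -- Composing the inverse of `u` with v would give p a left inverse.
  set v : Fin 3 → MvPolynomial (Fin 2) K := ![A' * X 0, A' * X 1, -B'] with hv
  have hvh : ∀ i, (v i).IsHomogeneous (e + 1) := by
    intro i
    match i with
    | 0 => exact hA'h.mul (isHomogeneous_X _ _)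
    | 1 => exact hA'h.mul (isHomogeneous_X _ _)
    | 2 => exact hB'h.neg
  have hhat : ∀ {G : PolyX K}, G.IsHomogeneous l →
      g ^ l * aeval ![p0, p1] (aeval v G) = aeval ![p0, p1] A' ^ l * aeval u G := by
    intro G hG
    rw [← AlgHom.comp_apply, comp_aeval, ← aeval_mul_of_isHomogeneous hG,
      ← aeval_mul_of_isHomogeneous hG]
    congr 2
    ext1 i
    match i with
    | 0 => simp [hv, hu0]; ring
    | 1 => simp [hv, hu1]; ring
    | 2 => simp only [hv, Matrix.cons_val, map_neg]; linear_combination -hrel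
  have hz := eq_zero_of_X_mul_aeval_pencil_eq h0 h1 hp (hA.aeval v hvh) (hB.aeval v hvh) (by
    apply mul_left_cancel₀ (pow_ne_zero l hg)
    linear_combination X 0 * hhat hB - X 1 * hhat hA + aeval ![p0, p1] A' ^ l * hAB)
  have hA0 := hhat hA
  have hB0 := hhat hB
  rw [hz.1, map_zero, mul_zero, eq_comm] at hA0
  rw [hz.2, map_zero, mul_zero, eq_comm] at hB0
  rcases hne with h | h
  · exact h ((mul_eq_zero.1 hA0).resolve_left (pow_ne_zero _ hA'p))
  · exact h ((mul_eq_zero.1 hB0).resolve_left (pow_ne_zero _ hA'p))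

end LastVariable

end ReesCurve

namespace ReesCurve

/-! ### Quadratic forms in T and identification of multiples of the implicit equation. -/

section Determinant

variable {K : Type*} [Field K]

theorem eq_sum_coeffT_of_isHomogeneous_two {G : PolyTX K} (hG : G.IsHomogeneous 2) :
    G = C (coeffT 2 0 G) * varT 0 ^ 2 + C (coeffT 1 1 G) * (varT 0 * varT 1)
      + C (coeffT 0 2 G) * varT 1 ^ 2 := by
  conv_lhs => rw [IsHomogeneous.eq_sum_binary hG]
  simp only [Finset.sum_range_succ, Finset.sum_range_zero, coeffT, varT]
  ring

theorem eq_sum_coeffT_of_isHomogeneous_one {G : PolyTX K} (hG : G.IsHomogeneous 1) :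
    G = C (coeffT 1 0 G) * varT 0 + C (coeffT 0 1 G) * varT 1 := by
  conv_lhs => rw [IsHomogeneous.eq_sum_binary hG]
  simp only [Finset.sum_range_succ, Finset.sum_range_zero, coeffT, varT]
  ring

theorem evalTX_of_isHomogeneous_two {G : PolyTX K} (hG : G.IsHomogeneous 2) (x : Fin 3 → K)
    (r : Fin 2 → K) : evalTX x r G = eval x (coeffT 2 0 G) * r 0 ^ 2
      + eval x (coeffT 1 1 G) * (r 0 * r 1) + eval x (coeffT 0 2 G) * r 1 ^ 2 := by
  conv_lhs => rw [eq_sum_coeffT_of_isHomogeneous_two hG]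
  simp

/-- The resultant of two binary quadratic forms, the first of which splits. -/
theorem exists_roots_of_binary_quadratic {f₀ f₁ f₂ : K} {r : Fin 2 → K} (hr : r ≠ 0)
    (hf : ¬ (f₀ = 0 ∧ f₁ = 0 ∧ f₂ = 0)) (h : f₀ * r 0 ^ 2 + f₁ * (r 0 * r 1) + f₂ * r 1 ^ 2 = 0) :
    ∃ s : Fin 2 → K, s ≠ 0 ∧ f₀ = r 1 * s 1 ∧ f₁ = -(r 1 * s 0 + r 0 * s 1) ∧ f₂ = r 0 * s 0 := by
  have key : ∃ a b, f₀ = r 1 * b ∧ f₁ = -(r 1 * a + r 0 * b) ∧ f₂ = r 0 * a := by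
    by_cases h0 : r 0 = 0
    · have h1 : r 1 ≠ 0 := by
        intro h1; apply hr; ext i; fin_cases i <;> simp [h0, h1]
      refine ⟨-f₁ / r 1, f₀ / r 1, by field_simp, by rw [h0]; field_simp; ring, ?_⟩
      simp [h0, h1] at h
      simp [h0, h]
    · refine ⟨f₂ / r 0, -(f₁ + r 1 * (f₂ / r 0)) / r 0, ?_, ?_, ?_⟩
      · field_simp
        linear_combination h
      · field_simp; ring
      · field_simp
  obtain ⟨a, b, e0, e1, e2⟩ := key
  refine ⟨![a, b], ?_, e0, e1, e2⟩
  intro hs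
  have ha : a = 0 := by simpa using congrFun hs 0
  have hb : b = 0 := by simpa using congrFun hs 1
  exact hf (by simp [e0, e1, e2, ha, hb])

/-- If a form `D` of `𝒦 ∩ 𝕂[X]` restricts to every line through `(0 : 0 : 1)` as a nonzero
polynomial of degree at most two, it is a constant multiple of the implicit equation as soon as
this has degree at least two in `X₂`. -/
theorem eq_C_mul_of_isImplicitEquation [IsAlgClosed K] {u : Fin 3 → PolyT K} {E D : PolyX K} {n : ℕ}
    (hE : IsImplicitEquation u E) (hD : D.IsHomogeneous n) (hDu : C D ∈ reesIdeal u)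
    (hline : ∀ y : Fin 2 → K, y ≠ 0 → ∃ q : Polynomial K, q ≠ 0 ∧ q.natDegree ≤ 2 ∧
      ∀ z, eval ![y 0, y 1, z] D = q.eval z)
    (hEdeg : ∀ m, E.IsHomogeneous m → 2 ≤ (toPolyX2 E).natDegree) :
    ∃ c : K, c ≠ 0 ∧ D = C c * E := by
  have hinf : Infinite K := IsAlgClosed.instInfinite
  obtain ⟨c, hc⟩ : E ∣ D := by
    rw [← Ideal.mem_span_singleton, hE.2]; exact hDu
  have heval : ∀ (G : PolyX K) (y : Fin 2 → K) (z : K),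
      ((toPolyX2 G).map (eval y)).eval z = eval ![y 0, y 1, z] G := by
    intro G y z
    have := eval₂_toPolyX2 (S := K) ![y 0, y 1, z] G
    simp only [Matrix.cons_val] at this
    rw [aeval_eq_eval] at this
    rw [Polynomial.eval_map, ← this]
    congr 1
    apply MvPolynomial.ringHom_ext
    · intro a; simp
    · intro i; fin_cases i <;> simp
  have hD0 : D ≠ 0 := by
    rintro rfl
    obtain ⟨q, hq, -, h⟩ := hline ![1, 0] (by intro h; simpa using congrFun h 0)
    apply hq
    apply Polynomial.funext
    intro z
    rw [← h z]; simp
  have hdeg : (toPolyX2 D).natDegree ≤ 2 := by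
    rw [Polynomial.natDegree_le_iff_coeff_eq_zero]
    intro i hi
    have : X 0 * (toPolyX2 D).coeff i = 0 := by
      apply MvPolynomial.funext
      intro y
      by_cases hy : y = 0
      · simp [hy]
      obtain ⟨q, -, hq2, h⟩ := hline y hy
      have hq : (toPolyX2 D).map (eval y) = q := by
        apply Polynomial.funext
        intro z
        rw [heval, h]
      have h1 := congrArg (fun p => Polynomial.coeff p i) hq
      simp only [Polynomial.coeff_map] at h1
      rw [Polynomial.coeff_eq_zero_of_natDegree_lt (lt_of_le_of_lt hq2 hi)] at h1
      simp [h1]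
    exact (mul_eq_zero.1 this).resolve_left (X_ne_zero _)
  have hE0 : E ≠ 0 := left_ne_zero_of_mul (hc ▸ hD0)
  have hc0 : c ≠ 0 := right_ne_zero_of_mul (hc ▸ hD0)
  have hEh := isHomogeneous_left_of_mul (hc ▸ hD) (hc ▸ hD0)
  have hch : c.IsHomogeneous c.totalDegree := by
    rw [mul_comm] at hc
    exact isHomogeneous_left_of_mul (hc ▸ hD) (hc ▸ hD0)
  -- X₂-degrees add: D has at most 2 and E already has at least 2.
  have hcdeg : (toPolyX2 c).natDegree = 0 := by
    have h1 := hEdeg _ hEh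
    have h2 : (toPolyX2 D).natDegree = (toPolyX2 E).natDegree + (toPolyX2 c).natDegree := by
      rw [hc, map_mul, Polynomial.natDegree_mul (by simpa using hE0) (by simpa using hc0)]
    omega
  rcases Nat.eq_zero_or_pos c.totalDegree with h0 | hpos
  · have hC := totalDegree_eq_zero_iff_eq_C.1 h0
    refine ⟨c.coeff 0, ?_, by rw [← hC, hc, mul_comm]⟩
    intro h; rw [h, C_0] at hC; exact hc0 hC
  · exfalso
    -- The cofactor is a binary form in X₀, X₁; at a zero `y` of it, D would vanish on the whole
    -- line over `y`.
    obtain ⟨y, hy, hy0⟩ := exists_eval_eq_zero_of_isHomogeneous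
      (coeff_toPolyX2_isHomogeneous hch (zero_add _)) hpos
    obtain ⟨q, hq, -, h⟩ := hline y hy
    apply hq
    apply Polynomial.funext
    intro z
    rw [← h z, hc, map_mul, ← heval c, Polynomial.eq_C_of_natDegree_eq_zero hcdeg]
    simp [hy0]

end Determinant

/-! ### Bidegrees and values of the 𝒟_T family. -/

section Family

variable {K : Type*} [Field K] {k : ℕ} {P Q : Fin 3 → PolyT K} {F : ℕ → PolyTX K}

theorem IsBihom.add {G H : PolyTX K} {i j : ℕ} (hG : IsBihom G i j) (hH : IsBihom H i j) :
    IsBihom (G + H) i j :=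
  ⟨hG.1.add hH.1, fun m => by rw [coeff_add]; exact (hG.2 m).add (hH.2 m)⟩

theorem IsBihom.sub {G H : PolyTX K} {i j : ℕ} (hG : IsBihom G i j) (hH : IsBihom H i j) :
    IsBihom (G - H) i j :=
  ⟨hG.1.sub hH.1, fun m => by rw [coeff_sub]; exact (hG.2 m).sub (hH.2 m)⟩

theorem IsBihom.C_mul {G : PolyTX K} {p : PolyX K} {i j l : ℕ} (hp : p.IsHomogeneous l)
    (hG : IsBihom G i j) : IsBihom (C p * G) i (l + j) :=
  ⟨hG.1.C_mul _, fun m => by rw [coeff_C_mul]; exact hp.mul (hG.2 m)⟩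

theorem isBihom_inclT {p : PolyT K} {i : ℕ} (hp : p.IsHomogeneous i) : IsBihom (inclT p) i 0 :=
  ⟨hp.map _, fun m => by rw [inclT, coeff_map]; exact isHomogeneous_C _ _⟩

theorem isBihom_varT (i : Fin 2) : IsBihom (varT i : PolyTX K) 1 0 := by
  have := isBihom_inclT (isHomogeneous_X K i)
  rwa [inclT, map_X] at this

theorem isBihom_syzForm {a : Fin 3 → PolyT K} {i : ℕ} (ha : ∀ j, (a j).IsHomogeneous i) :
    IsBihom (syzForm a) i 1 := by
  have h : ∀ j, IsBihom (inclT (a j) * varX j) i 1 := fun j => by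
    rw [mul_comm]; exact (isBihom_inclT (ha j)).C_mul (isHomogeneous_X _ _)
  rw [syzForm, Fin.sum_univ_three]
  exact ((h 0).add (h 1)).add (h 2)

theorem IsDTFamily.isBihom (hk : 3 ≤ k) (hF : IsDTFamily k P Q F) :
    IsBihom (F (k - 1)) 2 (k - 1) := by
  obtain ⟨G0, G1, h0, h1, -, hH⟩ := hF.2 (k - 2) (by omega) (by omega)
  rw [show k - 2 + 1 = k - 1 by omega] at hH h0 h1
  rw [show 2 * (k - (k - 1)) = 2 by omega] at h0 h1
  rw [hH]
  have e0 := h0.C_mul (isHomogeneous_X K (0 : Fin 3))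
  have e1 := h1.C_mul (isHomogeneous_X K (1 : Fin 3))
  rw [show 1 + (k - 2) = k - 1 by omega] at e0 e1
  exact e0.add e1

/-- Where (x₀, x₁) is `l` times (p⁰(r), p¹(r)), replacing p⁰, p¹ by X₀, X₁ just multiplies by `l`.
The value therefore does not depend on the decompositions. -/
theorem IsDTFamily.evalTX_eq (hF : IsDTFamily k P Q F) {x : Fin 3 → K} {r : Fin 2 → K} {l : K}
    (hx0 : x 0 = l * eval r (-P 1)) (hx1 : x 1 = l * eval r (P 0)) (j : ℕ) (hj : j + 1 ≤ k - 1) :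
    evalTX x r (F (j + 1)) = l ^ j * evalTX x r (syzForm Q) := by
  induction j with
  | zero => rw [zero_add, hF.1]; simp
  | succ j ih =>
    have ih := ih (by omega)
    obtain ⟨G0, G1, -, -, hG, hH⟩ := hF.2 (j + 1) (by omega) hj
    have e0 := congrArg (evalTX x r) hG
    have e1 := congrArg (evalTX x r) hH
    simp only [map_add, map_mul, evalTX_inclT, evalTX_varX] at e0 e1
    have e2 : evalTX x r (F (j + 1 + 1)) = l * evalTX x r (F (j + 1)) := by
      rw [e0, e1, hx0, hx1]; ring
    rw [e2, ih]; ring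

end Family

end ReesCurve

namespace ReesCurve

/-! ### The two forms linear in T and their determinant. -/

section LinearPair

variable {K : Type*} [Field K]

/-- The explicit solution of `IsLinearPair`. -/
noncomputable def linearPair (F M : PolyTX K) : Fin 2 → PolyTX K :=
  ![C (coeffT 2 0 M * coeffT 1 1 F - coeffT 2 0 F * coeffT 1 1 M) * varT 0
      + C (coeffT 2 0 M * coeffT 0 2 F - coeffT 2 0 F * coeffT 0 2 M) * varT 1,
    C (coeffT 0 2 M * coeffT 2 0 F - coeffT 0 2 F * coeffT 2 0 M) * varT 0
      + C (coeffT 0 2 M * coeffT 1 1 F - coeffT 0 2 F * coeffT 1 1 M) * varT 1]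

variable {F M : PolyTX K}

theorem varT_ne_zero (i : Fin 2) : (varT i : PolyTX K) ≠ 0 := X_ne_zero i

theorem isLinearPair_linearPair (hF : F.IsHomogeneous 2) (hM : M.IsHomogeneous 2) :
    IsLinearPair F M (linearPair F M) := by
  have eF := eq_sum_coeffT_of_isHomogeneous_two hF
  have eM := eq_sum_coeffT_of_isHomogeneous_two hM
  simp only [IsLinearPair, linearPair, Matrix.cons_val, map_sub, map_mul]
  constructor
  · linear_combination C (coeffT 2 0 M) * eF - C (coeffT 2 0 F) * eM
  · linear_combination C (coeffT 0 2 M) * eF - C (coeffT 0 2 F) * eM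

theorem IsLinearPair.eq {L L' : Fin 2 → PolyTX K} (h : IsLinearPair F M L)
    (h' : IsLinearPair F M L') : L = L' := by
  funext i
  match i with
  | 0 => exact mul_left_cancel₀ (varT_ne_zero 1) (h.1.symm.trans h'.1)
  | 1 => exact mul_left_cancel₀ (varT_ne_zero 0) (h.2.symm.trans h'.2)

theorem IsLinearPair.mem_reesIdeal {u : Fin 3 → PolyT K} {L : Fin 2 → PolyTX K}
    (h : IsLinearPair F M L) (hF : F ∈ reesIdeal u) (hM : M ∈ reesIdeal u) (i : Fin 2) :
    L i ∈ reesIdeal u := by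
  have hprime : (reesIdeal u).IsPrime := RingHom.ker_isPrime _
  have hT : ∀ i, (varT i : PolyTX K) ∉ reesIdeal u := by
    intro i hi
    have : reesMap u (varT i) = 0 := hi
    simp [reesMap, varT] at this
  match i with
  | 0 =>
    refine (hprime.mem_or_mem ?_).resolve_left (hT 1)
    rw [← h.1]
    exact sub_mem (Ideal.mul_mem_left _ _ hF) (Ideal.mul_mem_left _ _ hM)
  | 1 =>
    refine (hprime.mem_or_mem ?_).resolve_left (hT 0)
    rw [← h.2]
    exact sub_mem (Ideal.mul_mem_left _ _ hF) (Ideal.mul_mem_left _ _ hM)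

theorem coeffT_linear (a b : PolyX K) :
    coeffT 1 0 (C a * varT 0 + C b * varT 1) = a ∧ coeffT 0 1 (C a * varT 0 + C b * varT 1) = b := by
  have h : (Finsupp.single (0 : Fin 2) 1 : Fin 2 →₀ ℕ) ≠ Finsupp.single 1 1 := by
    intro h; simpa using DFunLike.congr_fun h 0
  constructor <;> simp [coeffT, varT, coeff_X, h, h.symm]

theorem isBihom_linear {a b : PolyX K} {j : ℕ} (ha : a.IsHomogeneous j) (hb : b.IsHomogeneous j) :
    IsBihom (C a * varT 0 + C b * varT 1) 1 j :=
  ((isBihom_varT 0).C_mul ha).add ((isBihom_varT 1).C_mul hb)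

theorem isBihom_linearPair {m n : ℕ} (hF : IsBihom F 2 m) (hM : IsBihom M 2 n) (i : Fin 2) :
    IsBihom (linearPair F M i) 1 (m + n) := by
  have h : ∀ a b c d, (coeffT a b M * coeffT c d F - coeffT a b F * coeffT c d M).IsHomogeneous
      (m + n) := fun a b c d => by
    refine IsHomogeneous.sub ?_ ((hF.2 _).mul (hM.2 _))
    rw [add_comm]; exact (hM.2 _).mul (hF.2 _)
  match i with
  | 0 => exact isBihom_linear (h _ _ _ _) (h _ _ _ _)
  | 1 => exact isBihom_linear (h _ _ _ _) (h _ _ _ _)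

/-- The determinant of the coefficients of two forms that are linear in `T`. -/
noncomputable def linDet (G H : PolyTX K) : PolyX K :=
  linCoeff G 0 * linCoeff H 1 - linCoeff H 0 * linCoeff G 1

/-- The right-hand side is minus the Bézout form of the resultant of two binary quadratic forms. -/
theorem linDet_linearPair : linDet (linearPair F M 0) (linearPair F M 1)
    = (coeffT 2 0 F * coeffT 1 1 M - coeffT 1 1 F * coeffT 2 0 M)
        * (coeffT 1 1 F * coeffT 0 2 M - coeffT 0 2 F * coeffT 1 1 M)
      - (coeffT 2 0 F * coeffT 0 2 M - coeffT 0 2 F * coeffT 2 0 M) ^ 2 := by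
  simp only [linDet, linCoeff, linearPair, Matrix.cons_val, coeffT_linear]
  ring

theorem eq_linCoeff {G : PolyTX K} (hG : G.IsHomogeneous 1) :
    G = C (linCoeff G 0) * varT 0 - C (linCoeff G 1) * varT 1 := by
  conv_lhs => rw [eq_sum_coeffT_of_isHomogeneous_one hG]
  simp only [linCoeff, Matrix.cons_val, map_neg]
  ring

/-- Eliminating T₀ leaves T₁ times the determinant, and T₁ is not in the prime ideal. -/
theorem C_linDet_mem {I : Ideal (PolyTX K)} (hI : I.IsPrime) (hT : varT 1 ∉ I) {G H : PolyTX K}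
    (hG : G.IsHomogeneous 1) (hH : H.IsHomogeneous 1) (hGI : G ∈ I) (hHI : H ∈ I) :
    C (linDet G H) ∈ I := by
  have e : varT 1 * C (linDet G H) = C (linCoeff H 0) * G - C (linCoeff G 0) * H := by
    have eG := eq_linCoeff hG
    have eH := eq_linCoeff hH
    simp only [linDet, map_sub, map_mul]
    linear_combination C (linCoeff G 0) * eH - C (linCoeff H 0) * eG
  refine (hI.mem_or_mem ?_).resolve_left hT
  rw [e]
  exact sub_mem (I.mul_mem_left _ hGI) (I.mul_mem_left _ hHI)

theorem resT_one_one {G H : PolyTX K} (hG : G.IsHomogeneous 1) (hH : H.IsHomogeneous 1) :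
    resT 1 1 G H = -linDet G H := by
  have key : ∀ {G : PolyTX K}, G.IsHomogeneous 1 →
      aeval ![Polynomial.X, (1 : Polynomial (PolyX K))] G
        = Polynomial.C (coeffT 1 0 G) * Polynomial.X + Polynomial.C (coeffT 0 1 G) := by
    intro G hG
    conv_lhs => rw [eq_sum_coeffT_of_isHomogeneous_one hG]
    simp [varT, Polynomial.C_eq_algebraMap]
  rw [resT, key hG, key hH, Polynomial.resultant, Matrix.det_fin_two]
  simp [Polynomial.sylvester, linDet, linCoeff, Fin.addCases]
  ring

end LinearPair

end ReesCurve

namespace ReesCurve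

/-! ### The basis of 𝒦_{1,*}. -/

section Basis

variable {K : Type*} [Field K] {u : Fin 3 → PolyT K}

theorem reesIdeal_isPrime : (reesIdeal u).IsPrime := RingHom.ker_isPrime _

theorem varT_notMem_reesIdeal (i : Fin 2) : (varT i : PolyTX K) ∉ reesIdeal u := by
  intro hi
  have : reesMap u (varT i) = 0 := hi
  simp [reesMap, varT] at this

theorem linearIndependent_of_linDet_ne_zero {L : Fin 2 → PolyTX K}
    (hD : linDet (L 0) (L 1) ≠ 0) : LinearIndependent (PolyX K) L := by
  rw [Fintype.linearIndependent_iff]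
  intro g hg
  rw [Fin.sum_univ_two] at hg
  have h0 := congrArg (coeffT 1 0) hg
  have h1 := congrArg (coeffT 0 1) hg
  simp only [coeffT, coeff_add, coeff_smul, coeff_zero, smul_eq_mul] at h0 h1
  have e0 : g 0 * linDet (L 0) (L 1) = 0 := by
    simp only [linDet, linCoeff, Matrix.cons_val, coeffT]
    linear_combination -(coeff (Finsupp.single 0 0 + Finsupp.single 1 1) (L 1)) * h0
      + coeff (Finsupp.single 0 1 + Finsupp.single 1 0) (L 1) * h1
  have e1 : g 1 * linDet (L 0) (L 1) = 0 := by
    simp only [linDet, linCoeff, Matrix.cons_val, coeffT]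
    linear_combination coeff (Finsupp.single 0 0 + Finsupp.single 1 1) (L 0) * h0
      - coeff (Finsupp.single 0 1 + Finsupp.single 1 0) (L 0) * h1
  intro i
  match i with
  | 0 => exact (mul_eq_zero.1 e0).resolve_right hD
  | 1 => exact (mul_eq_zero.1 e1).resolve_right hD

theorem C_linDet_mul {G H₀ H₁ : PolyTX K} (hG : G.IsHomogeneous 1) (h₀ : H₀.IsHomogeneous 1)
    (h₁ : H₁.IsHomogeneous 1) :
    C (linDet H₀ H₁) * G = C (linDet G H₁) * H₀ + C (linDet H₀ G) * H₁ := by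
  have eG := eq_linCoeff hG
  have e₀ := eq_linCoeff h₀
  have e₁ := eq_linCoeff h₁
  have e : ∀ A B : PolyTX K, (C (linDet A B) : PolyTX K)
      = C (linCoeff A 0) * C (linCoeff B 1) - C (linCoeff B 0) * C (linCoeff A 1) :=
    fun A B => by simp only [linDet, map_sub, map_mul]
  linear_combination C (linDet H₀ H₁) * eG - C (linDet G H₁) * e₀ - C (linDet H₀ G) * e₁
    + (C (linCoeff G 0) * varT 0 - C (linCoeff G 1) * varT 1) * e H₀ H₁
    - (C (linCoeff H₀ 0) * varT 0 - C (linCoeff H₀ 1) * varT 1) * e G H₁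
    - (C (linCoeff H₁ 0) * varT 0 - C (linCoeff H₁ 1) * varT 1) * e H₀ G

/-- In Cramer's rule for G, all numerators are determinants of elements of 𝒦_{1,*}, hence multiples
of E; the denominator is E up to a constant, so the coordinates of G are polynomials. -/
theorem span_eq_reesIdealOne {L : Fin 2 → PolyTX K} (hL1 : ∀ i, (L i).IsHomogeneous 1)
    (hL : ∀ i, L i ∈ reesIdeal u) {E : PolyX K} (hE : IsImplicitEquation u E) {c : K} (hc : c ≠ 0)
    (hD : linDet (L 0) (L 1) = C c * E) :
    Submodule.span (PolyX K) (Set.range L) = reesIdealOne u := by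
  apply le_antisymm
  · rw [Submodule.span_le]
    rintro _ ⟨i, rfl⟩
    exact ⟨hL1 i, hL i⟩
  · rintro G ⟨hG1, hG⟩
    have hG1 : G.IsHomogeneous 1 := hG1
    have hmem : ∀ {G H : PolyTX K}, G.IsHomogeneous 1 → H.IsHomogeneous 1 → G ∈ reesIdeal u →
        H ∈ reesIdeal u → ∃ a, linDet G H = a * linDet (L 0) (L 1) := by
      intro G H hG1 hH1 hG hH
      have h1 : C (linDet G H) ∈ reesIdeal u :=
        C_linDet_mem reesIdeal_isPrime (varT_notMem_reesIdeal 1) hG1 hH1 hG hH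
      have h2 : linDet G H ∈ Ideal.span {E} := by rw [hE.2]; exact h1
      obtain ⟨a, ha⟩ := Ideal.mem_span_singleton.1 h2
      refine ⟨C c⁻¹ * a, ?_⟩
      have hcc : (C c⁻¹ * C c : PolyX K) = 1 := by rw [← C_mul, inv_mul_cancel₀ hc, C_1]
      rw [hD, ha]
      linear_combination -E * a * hcc
    obtain ⟨a, ha⟩ := hmem hG1 (hL1 1) hG (hL 1)
    obtain ⟨b, hb⟩ := hmem (hL1 0) hG1 (hL 0) hG
    have hD0 : linDet (L 0) (L 1) ≠ 0 := by
      rw [hD]; exact mul_ne_zero (by simpa using hc) hE.1.ne_zero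
    have key : G = a • L 0 + b • L 1 := by
      apply mul_left_cancel₀ (C_ne_zero.2 hD0 : (C (linDet (L 0) (L 1)) : PolyTX K) ≠ 0)
      have e : C (linDet (L 0) (L 1)) * G = C (linDet G (L 1)) * L 0 + C (linDet (L 0) G) * L 1 :=
        C_linDet_mul hG1 (hL1 0) (hL1 1)
      rw [e, ha, hb]
      simp only [map_mul, smul_eq_C_mul]
      ring
    rw [key]
    exact add_mem (Submodule.smul_mem _ _ (Submodule.subset_span ⟨0, rfl⟩))
      (Submodule.smul_mem _ _ (Submodule.subset_span ⟨1, rfl⟩))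

end Basis

/-! ### The operator 𝒟_X on the linear forms. -/

section DX

variable {K : Type*} [Field K]

theorem coeffT_syzForm (a b : ℕ) (P : Fin 3 → PolyT K) :
    coeffT a b (syzForm P) = ∑ i, C ((P i).coeff (Finsupp.single 0 a + Finsupp.single 1 b)) * X i := by
  simp [coeffT, syzForm, inclT, varX, coeff_sum, mul_comm _ (C (X _)), coeff_C_mul, coeff_map,
    mul_comm (X _)]

theorem syzForm_of_eq_zero {P : Fin 3 → PolyT K} (hP2 : P 2 = 0) :
    syzForm P = varX 0 * inclT (P 0) - varX 1 * inclT (-P 1) := by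
  simp [syzForm, Fin.sum_univ_three, hP2]
  ring

theorem linearPair_sub {F G M : PolyTX K} (a b : PolyX K) (i : Fin 2) :
    linearPair (C a * F - C b * G) M i = C a * linearPair F M i - C b * linearPair G M i := by
  match i with
  | 0 | 1 =>
    simp only [linearPair, Matrix.cons_val, coeffT, coeff_sub, coeff_C_mul, map_sub, map_mul]
    ring

/-- A three-term identity for an alternating bilinear elimination. For p¹, p⁰ in place of F, G its
left side is a value of 𝒟_X, and its right side is visibly a multiple of M. -/
theorem mul_linearPair_sub_mul_linearPair {F G M : PolyTX K} (hF : F.IsHomogeneous 2)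
    (hG : G.IsHomogeneous 2) (hM : M.IsHomogeneous 2) (i : Fin 2) :
    G * linearPair F M i - F * linearPair G M i = linearPair F G i * M := by
  have hFM := isLinearPair_linearPair hF hM
  have hGM := isLinearPair_linearPair hG hM
  have hFG := isLinearPair_linearPair hF hG
  match i with
  | 0 =>
    apply mul_left_cancel₀ (varT_ne_zero 1)
    linear_combination -G * hFM.1 + F * hGM.1 + M * hFG.1
  | 1 =>
    apply mul_left_cancel₀ (varT_ne_zero 0)
    linear_combination -G * hFM.2 + F * hGM.2 + M * hFG.2

theorem syzForm_dvd_sub_of_isDX {P : Fin 3 → PolyT K} (hP2 : P 2 = 0) {i j : ℕ}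
    {G H H' : PolyTX K} (hH : IsDX (-P 1) (P 0) i j G H) (hH' : IsDX (-P 1) (P 0) i j G H') :
    syzForm P ∣ H - H' := by
  obtain ⟨G0, G1, -, -, hG, hH⟩ := hH
  obtain ⟨G0', G1', -, -, hG', hH'⟩ := hH'
  have hprime : Prime (varX 0 : PolyTX K) := (prime_C_iff _).2 X_prime
  -- Two decompositions differ by a syzygy of X₀, X₁, necessarily a multiple W of (-X₁, X₀);
  -- applying p⁰, p¹ to it gives W F_{2,1}.
  have hdvd : (varX 0 : PolyTX K) ∣ G1 - G1' := by
    have h : (varX 0 : PolyTX K) ∣ varX 1 * (G1 - G1') :=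
      ⟨G0' - G0, by linear_combination hG' - hG⟩
    refine (hprime.dvd_or_dvd h).resolve_left ?_
    rintro ⟨q, hq⟩
    have := congrArg (evalTX ![0, 1, 0] 0) hq
    simp at this
  obtain ⟨W, hW⟩ := hdvd
  have h0 : G0 - G0' = -(varX 1 * W) := by
    apply mul_left_cancel₀ hprime.ne_zero
    linear_combination hG' - hG - varX 1 * hW
  refine ⟨W, ?_⟩
  rw [hH, hH', syzForm_of_eq_zero hP2]
  linear_combination inclT (-P 1) * h0 + inclT (P 0) * hW

variable {P : Fin 3 → PolyT K} {M : PolyTX K} {n : ℕ}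

theorem linearPair_syzForm (hP2 : P 2 = 0) (i : Fin 2) :
    linearPair (syzForm P) M i = varX 0 * linearPair (inclT (P 0)) M i
      + varX 1 * -linearPair (inclT (-P 1)) M i := by
  rw [syzForm_of_eq_zero hP2, varX, varX, linearPair_sub]
  ring

theorem isDX_linearPair (hP : ∀ i, (P i).IsHomogeneous 2) (hP2 : P 2 = 0) (hM : IsBihom M 2 n)
    (i : Fin 2) : IsDX (-P 1) (P 0) 1 n (linearPair (syzForm P) M i)
      (linearPair (inclT (P 0)) (inclT (-P 1)) i * M) := by
  have h0 := isBihom_inclT (hP 0)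
  have h1 := isBihom_inclT (hP 1).neg
  refine ⟨linearPair (inclT (P 0)) M i, -linearPair (inclT (-P 1)) M i, ?_, ?_,
    linearPair_syzForm hP2 i, ?_⟩
  · simpa using isBihom_linearPair h0 hM i
  · have := isBihom_linearPair h1 hM i
    rw [zero_add] at this
    exact ⟨this.1.neg, fun m => by rw [coeff_neg]; exact (this.2 m).neg⟩
  · rw [← mul_linearPair_sub_mul_linearPair h0.1 h1.1 hM.1]
    ring

theorem linearPair_syzForm_mem_span (hP2 : P 2 = 0) (i : Fin 2) :
    linearPair (syzForm P) M i ∈ Ideal.span {varX 0, varX 1} :=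
  Ideal.mem_span_pair.2 ⟨linearPair (inclT (P 0)) M i, -linearPair (inclT (-P 1)) M i, by
    rw [linearPair_syzForm hP2]; ring⟩

end DX

/-! ### Restriction to the lines through (0:0:1). -/

section Lines

variable {K : Type*} [Field K] {k : ℕ} {u P Q : Fin 3 → PolyT K}
  {F : ℕ → PolyTX K} {c : K}

theorem pencil_ne_zero {d : ℕ} (hu : IsParametrization d u) (hP2 : P 2 = 0) (hc : c ≠ 0)
    (h0 : P 1 * Q 2 - P 2 * Q 1 = C c * u 0) (h1 : P 2 * Q 0 - P 0 * Q 2 = C c * u 1)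
    (h2 : P 0 * Q 1 - P 1 * Q 0 = C c * u 2) {r : Fin 2 → K} (hr : r ≠ 0) :
    (![eval r (-P 1), eval r (P 0)] : Fin 2 → K) ≠ 0 := by
  intro h
  have hz0 : eval r (P 0) = 0 := by simpa using congrFun h 1
  have hz1 : eval r (P 1) = 0 := by simpa using congrFun h 0
  obtain ⟨i, hi⟩ := exists_eval_ne_zero_of_isParametrization hu hr
  have e0 := congrArg (eval r) h0
  have e1 := congrArg (eval r) h1
  have e2 := congrArg (eval r) h2
  simp only [map_sub, map_mul, hz0, hz1, hP2, map_zero, eval_C, zero_mul, sub_zero] at e0 e1 e2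
  apply hi
  match i with
  | 0 => exact (mul_eq_zero.1 e0.symm).resolve_left hc
  | 1 => exact (mul_eq_zero.1 e1.symm).resolve_left hc
  | 2 => exact (mul_eq_zero.1 e2.symm).resolve_left hc

/-- On a line through `(0 : 0 : 1)`, the last member of the family at a root of `F_{2,1}` is a
nonzero polynomial of degree at most one in `X₂`. -/
theorem exists_linear_evalTX_family {d : ℕ} (hk : 3 ≤ k) (hu : IsParametrization d u)
    (hP2 : P 2 = 0) (hc : c ≠ 0)
    (h0 : P 1 * Q 2 - P 2 * Q 1 = C c * u 0) (h1 : P 2 * Q 0 - P 0 * Q 2 = C c * u 1)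
    (h2 : P 0 * Q 1 - P 1 * Q 0 = C c * u 2) (hF : IsDTFamily k P Q F) {y r : Fin 2 → K}
    (hy : y ≠ 0) (hr : r ≠ 0) (hyr : y 0 * eval r (P 0) + y 1 * eval r (P 1) = 0) :
    ∃ q : Polynomial K, q ≠ 0 ∧ q.natDegree ≤ 1 ∧
      ∀ z, evalTX ![y 0, y 1, z] r (F (k - 1)) = q.eval z := by
  obtain ⟨l, hl, hyl⟩ := exists_smul_eq_of_mul_eq_mul
    (pencil_ne_zero hu hP2 hc h0 h1 h2 hr) hy (by simp; linear_combination -hyr)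
  have hy0 : y 0 = l * eval r (-P 1) := by simpa using hyl 0
  have hy1 : y 1 = l * eval r (P 0) := by simpa using hyl 1
  have e0 := congrArg (eval r) h0
  have e1 := congrArg (eval r) h1
  have e2 := congrArg (eval r) h2
  simp only [map_sub, map_mul, hP2, map_zero, eval_C, zero_mul, sub_zero] at e0 e1 e2
  -- On this line F_{d-2,1} at `r` equals Q₂ z + l (p⁰ Q₀ + p¹ Q₁), and the last bracket is c u₂. If
  -- Q₂ and u₂ both vanished at `r`, so would u₀ and u₁.
  refine ⟨Polynomial.C (l ^ (k - 2)) * (Polynomial.C (eval r (Q 2)) * Polynomial.X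
    + Polynomial.C (l * (c * eval r (u 2)))), ?_, ?_, fun z => ?_⟩
  · refine mul_ne_zero (by simpa using pow_ne_zero _ hl) fun h => ?_
    have hq : eval r (Q 2) = 0 := by
      have := congrArg (fun p => Polynomial.coeff p 1) h
      simpa [Polynomial.coeff_C] using this
    have hu2 : eval r (u 2) = 0 := by
      have := congrArg (fun p => Polynomial.coeff p 0) h
      simpa [hl, hc] using this
    obtain ⟨i, hi⟩ := exists_eval_ne_zero_of_isParametrization hu hr
    apply hi
    rw [hq, mul_zero] at e0
    rw [hq, mul_zero, sub_zero] at e1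
    match i with
    | 0 => exact (mul_eq_zero.1 e0.symm).resolve_left hc
    | 1 => exact (mul_eq_zero.1 e1.symm).resolve_left hc
    | 2 => exact hu2
  · exact (Polynomial.natDegree_C_mul_le _ _).trans Polynomial.natDegree_linear_le
  · have := hF.evalTX_eq (x := ![y 0, y 1, z]) (r := r) (l := l) hy0 hy1 (k - 2) (by omega)
    rw [show k - 2 + 1 = k - 1 by omega] at this
    rw [this, evalTX_syzForm]
    simp only [Matrix.cons_val, hy0, hy1, Polynomial.eval_mul, Polynomial.eval_add,
      Polynomial.eval_C, Polynomial.eval_X, ← e2, map_neg]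
    ring

theorem exists_eval_linDet_line [IsAlgClosed K] {d : ℕ} (hk : 3 ≤ k) (hu : IsParametrization d u)
    (hP : ∀ i, (P i).IsHomogeneous 2) (hP2 : P 2 = 0) (hc : c ≠ 0)
    (h0 : P 1 * Q 2 - P 2 * Q 1 = C c * u 0) (h1 : P 2 * Q 0 - P 0 * Q 2 = C c * u 1)
    (h2 : P 0 * Q 1 - P 1 * Q 0 = C c * u 2) (hF : IsDTFamily k P Q F) {y : Fin 2 → K}
    (hy : y ≠ 0) :
    ∃ q : Polynomial K, q ≠ 0 ∧ q.natDegree ≤ 2 ∧ ∀ z, eval ![y 0, y 1, z]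
      (linDet (linearPair (syzForm P) (F (k - 1)) 0) (linearPair (syzForm P) (F (k - 1)) 1))
        = q.eval z := by
  have hpen : ∀ r : Fin 2 → K, r ≠ 0 → (![eval r (-P 1), eval r (P 0)] : Fin 2 → K) ≠ 0 :=
    fun r hr => pencil_ne_zero hu hP2 hc h0 h1 h2 hr
  have hPF : (syzForm P).IsHomogeneous 2 := (isBihom_syzForm hP).1
  have hM := (hF.isBihom hk).1
  -- F_{2,1} does not involve X₂, so its roots are constant along the line.
  have hcoef : ∀ a b z, eval ![y 0, y 1, z] (coeffT a b (syzForm P))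
      = eval ![y 0, y 1, 0] (coeffT a b (syzForm P)) := by
    intro a b z
    simp [coeffT_syzForm, Fin.sum_univ_three, hP2]
  set f : ℕ → ℕ → K := fun a b => eval ![y 0, y 1, 0] (coeffT a b (syzForm P)) with hf
  have hquad : ∀ r : Fin 2 → K, y 0 * eval r (P 0) + y 1 * eval r (P 1)
      = f 2 0 * r 0 ^ 2 + f 1 1 * (r 0 * r 1) + f 0 2 * r 1 ^ 2 := by
    intro r
    rw [← evalTX_of_isHomogeneous_two hPF, evalTX_syzForm]
    simp
    ring
  obtain ⟨r, b, hr, hb, hr0, hr1⟩ := exists_eval_pencil_eq_smul (hP 1).neg (hP 0) hpen hy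
  have hyr : y 0 * eval r (P 0) + y 1 * eval r (P 1) = 0 := by
    rw [map_neg] at hr0
    linear_combination y 0 * hr1 - y 1 * hr0
  -- Otherwise every value of the surjective map p would be the single point `y`.
  have hne : ¬ (f 2 0 = 0 ∧ f 1 1 = 0 ∧ f 0 2 = 0) := by
    rintro ⟨z0, z1, z2⟩
    have hall : ∀ x : Fin 2 → K, x ≠ 0 → y 0 * x 1 - y 1 * x 0 = 0 := by
      intro x hx
      obtain ⟨r, b, -, hb, hr0, hr1⟩ := exists_eval_pencil_eq_smul (hP 1).neg (hP 0) hpen hx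
      have := hquad r
      rw [z0, z1, z2] at this
      rw [map_neg] at hr0
      apply mul_left_cancel₀ hb
      linear_combination this - y 0 * hr1 + y 1 * hr0
    apply hy
    ext i
    match i with
    | 0 => simpa using hall ![0, 1] (by intro h; simpa using congrFun h 1)
    | 1 => simpa using hall ![1, 0] (by intro h; simpa using congrFun h 0)
  obtain ⟨s, hs, e0, e1, e2⟩ := exists_roots_of_binary_quadratic hr hne (by rw [← hquad, hyr])
  have hys : y 0 * eval s (P 0) + y 1 * eval s (P 1) = 0 := by
    rw [hquad, e0, e1, e2]; ring
  obtain ⟨q, hq, hqd, hqe⟩ := exists_linear_evalTX_family hk hu hP2 hc h0 h1 h2 hF hy hr hyr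
  obtain ⟨q', hq', hqd', hqe'⟩ := exists_linear_evalTX_family hk hu hP2 hc h0 h1 h2 hF hy hs hys
  -- Poisson's formula: the determinant is minus the product of the values of F_{2,k-1} at the roots
  -- `r`, `s` of F_{2,1}, which may coincide.
  refine ⟨-(q * q'), neg_ne_zero.2 (mul_ne_zero hq hq'), ?_, fun z => ?_⟩
  · rw [Polynomial.natDegree_neg]
    exact Polynomial.natDegree_mul_le.trans (by omega)
  · rw [Polynomial.eval_neg, Polynomial.eval_mul, ← hqe, ← hqe', linDet_linearPair,
      evalTX_of_isHomogeneous_two hM, evalTX_of_isHomogeneous_two hM]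
    simp only [map_sub, map_mul, map_pow, hcoef]
    simp only [hf] at e0 e1 e2
    rw [e0, e1, e2]
    ring

end Lines

end ReesCurve

namespace ReesCurve

/-! ### Membership of the family in the Rees ideal. -/

section Membership

variable {K : Type*} [Field K] {k : ℕ} {u P Q : Fin 3 → PolyT K} {F : ℕ → PolyTX K} {c : K}

theorem syzForm_mem_reesIdeal [Infinite K] (hP : P ∈ syz u) : syzForm P ∈ reesIdeal u := by
  refine mem_reesIdeal_of_evalTX one_ne_zero fun r z _ => ?_
  have := congrArg (eval r) (mem_syz_iff.1 hP)
  simp only [map_add, map_mul, map_zero] at this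
  rw [evalTX_syzForm]
  linear_combination z * this

/-- At X = z u(r), (X₀, X₁) is -z Q₂(r)/c times (p⁰, p¹)(r), so F_{2,k-1} is a multiple of the value
of F_{d-2,1}, which is zero. -/
theorem family_mem_reesIdeal [Infinite K] (hk : 3 ≤ k) (hP2 : P 2 = 0) (hc : c ≠ 0)
    (h0 : P 1 * Q 2 - P 2 * Q 1 = C c * u 0) (h1 : P 2 * Q 0 - P 0 * Q 2 = C c * u 1)
    (hQs : Q ∈ syz u) (hF : IsDTFamily k P Q F) : F (k - 1) ∈ reesIdeal u := by
  refine mem_reesIdeal_of_evalTX one_ne_zero fun r z _ => ?_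
  have e0 := congrArg (eval r) h0
  have e1 := congrArg (eval r) h1
  simp only [map_sub, map_mul, hP2, map_zero, eval_C, zero_mul, sub_zero] at e0 e1
  have := hF.evalTX_eq (x := fun i => z * eval r (u i)) (r := r) (l := -(z * eval r (Q 2) / c))
    (by simp; field_simp; linear_combination -z * e0)
    (by field_simp; linear_combination -z * e1) (k - 2) (by omega)
  rw [show k - 2 + 1 = k - 1 by omega] at this
  rw [this, evalTX_eq_zero_of_mem (syzForm_mem_reesIdeal hQs), mul_zero]

theorem isHomogeneous_linDet {G H : PolyTX K} {i j : ℕ} (hG : IsBihom G 1 i) (hH : IsBihom H 1 j) :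
    (linDet G H).IsHomogeneous (i + j) := by
  refine IsHomogeneous.sub ((hG.2 _).mul (hH.2 _).neg) ?_
  rw [add_comm]
  exact (hH.2 _).mul (hG.2 _).neg

end Membership

end ReesCurve
-- The main theorem.
theorem mainTheorem6 {K : Type*} [Field K] [IsAlgClosed K] (k : ℕ) (hk : 3 ≤ k)
    (u P Q : Fin 3 → ReesCurve.PolyT K)
    (hu : ReesCurve.IsParametrization (2 * k) u)
    (hproper : ReesCurve.IsProper u)
    (hPQ : ReesCurve.IsMuBasis (2 * k) 2 u P Q)
    (E : ReesCurve.PolyX K) (hE : ReesCurve.IsImplicitEquation u E)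
    (hsing : 2 < ReesCurve.multAt E ![0, 0, 1])
    (F : ℕ → ReesCurve.PolyTX K) (hF : ReesCurve.IsDTFamily k P Q F) :
    (∃! L : Fin 2 → ReesCurve.PolyTX K,
      ReesCurve.IsLinearPair (ReesCurve.syzForm P) (F (k - 1)) L) ∧
    ∀ L : Fin 2 → ReesCurve.PolyTX K,
      ReesCurve.IsLinearPair (ReesCurve.syzForm P) (F (k - 1)) L →
      (∀ i, L i ∈ ReesCurve.reesIdeal u ∧ ReesCurve.IsBihom (L i) 1 k ∧
        L i ∈ Ideal.span {ReesCurve.varX 0, ReesCurve.varX 1}) ∧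
      ((∃ c : K, c ≠ 0 ∧
          ReesCurve.linCoeff (L 0) 0 * ReesCurve.linCoeff (L 1) 1 -
            ReesCurve.linCoeff (L 1) 0 * ReesCurve.linCoeff (L 0) 1 = MvPolynomial.C c * E) ∧
        (∃ c : K, c ≠ 0 ∧ ReesCurve.resT 1 1 (L 0) (L 1) = MvPolynomial.C c * E)) ∧
      (LinearIndependent (ReesCurve.PolyX K) L ∧
        Submodule.span (ReesCurve.PolyX K) (Set.range L) = ReesCurve.reesIdealOne u) ∧
      (∀ i, (∃ H, ReesCurve.IsDX (-P 1) (P 0) 1 (k - 1) (L i) H) ∧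
        ∀ H, ReesCurve.IsDX (-P 1) (P 0) 1 (k - 1) (L i) H →
          ∃ A : ReesCurve.PolyTX K, ReesCurve.syzForm P ∣ H - A * F (k - 1)) := by
  have hinf : Infinite K := IsAlgClosed.instInfinite
  obtain ⟨hd2, hP, hQ, hli, hspan⟩ := hPQ
  have hPs : P ∈ ReesCurve.syz u := hspan ▸ Submodule.subset_span (by simp)
  have hQs : Q ∈ ReesCurve.syz u := hspan ▸ Submodule.subset_span (by simp)
  obtain ⟨c, hc, h0, h1, h2⟩ :=
    ReesCurve.exists_cross_eq_smul hu (by omega) hP hQ hli hPs hQs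
  have hP2 : P 2 = 0 :=
    ReesCurve.eq_zero_of_two_lt_multAt hu hP hQ hPs hQs hc h0 h1 h2 hE hsing
  have hpen : ∀ r : Fin 2 → K, r ≠ 0 → (![eval r (-P 1), eval r (P 0)] : Fin 2 → K) ≠ 0 :=
    fun r hr => ReesCurve.pencil_ne_zero hu hP2 hc h0 h1 h2 hr
  have hPF := ReesCurve.isBihom_syzForm hP
  have hM := hF.isBihom hk
  have hPF_mem := ReesCurve.syzForm_mem_reesIdeal hPs
  have hM_mem := ReesCurve.family_mem_reesIdeal hk hP2 hc h0 h1 hQs hF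
  have hpair := ReesCurve.isLinearPair_linearPair hPF.1 hM.1
  refine ⟨⟨_, hpair, fun L hL => hL.eq hpair⟩, fun L hL => ?_⟩
  obtain rfl := hL.eq hpair
  set L := ReesCurve.linearPair (ReesCurve.syzForm P) (F (k - 1))
  have hbi : ∀ i, ReesCurve.IsBihom (L i) 1 k := fun i => by
    have := ReesCurve.isBihom_linearPair hPF hM i
    rwa [show 1 + (k - 1) = k by omega] at this
  have hLmem := hL.mem_reesIdeal hPF_mem hM_mem
  have hDmem := ReesCurve.C_linDet_mem ReesCurve.reesIdeal_isPrime
    (ReesCurve.varT_notMem_reesIdeal 1) (hbi 0).1 (hbi 1).1 (hLmem 0) (hLmem 1)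
  have hline : ∀ y : Fin 2 → K, y ≠ 0 → _ := fun y hy =>
    ReesCurve.exists_eval_linDet_line hk hu hP hP2 hc h0 h1 h2 hF hy
  have hEdeg : ∀ m, E.IsHomogeneous m → 2 ≤ (ReesCurve.toPolyX2 E).natDegree := by
    intro m hm
    -- The factor is g = -Q₂/c. If it were zero, u₀ = u₁ = 0, and any zero of u₂ would be a common
    -- zero of all three forms.
    obtain ⟨g, hg, hg0, hg1⟩ : ∃ g, g ≠ 0 ∧ u 0 = g * -P 1 ∧ u 1 = g * P 0 := by
      have hcc : (C c⁻¹ * C c : ReesCurve.PolyT K) = 1 := by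
        rw [← C_mul, inv_mul_cancel₀ hc, C_1]
      have e0 : u 0 = -(C c⁻¹ * Q 2) * -P 1 := by
        rw [hP2] at h0
        linear_combination -(u 0 * hcc) - C c⁻¹ * h0
      have e1 : u 1 = -(C c⁻¹ * Q 2) * P 0 := by
        rw [hP2] at h1
        linear_combination -(u 1 * hcc) - C c⁻¹ * h1
      refine ⟨_, fun hg => ?_, e0, e1⟩
      rw [hg, zero_mul] at e0 e1
      obtain ⟨r, hr, hr0⟩ := ReesCurve.exists_eval_eq_zero_of_isHomogeneous (hu.1 2) (by omega)
      obtain ⟨i, hi⟩ := ReesCurve.exists_eval_ne_zero_of_isParametrization hu hr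
      match i with
      | 0 => exact hi (by rw [e0, map_zero])
      | 1 => exact hi (by rw [e1, map_zero])
      | 2 => exact hi hr0
    have hEmem : C E ∈ ReesCurve.reesIdeal u := by
      have : E ∈ Ideal.span {E} := Ideal.mem_span_singleton_self E
      rwa [hE.2] at this
    exact ReesCurve.two_le_natDegree_toPolyX2 (hP 1).neg (hP 0) hpen hg hg0 hg1 hproper
      hE.1.ne_zero hm (ReesCurve.aeval_eq_zero_of_C_mem_reesIdeal hEmem)
  obtain ⟨b, hb, hD⟩ := ReesCurve.eq_C_mul_of_isImplicitEquation hE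
    (ReesCurve.isHomogeneous_linDet (hbi 0) (hbi 1)) hDmem hline hEdeg
  have hD0 : ReesCurve.linDet (L 0) (L 1) ≠ 0 := by
    rw [hD]; exact mul_ne_zero (by simpa using hb) hE.1.ne_zero
  refine ⟨fun i => ⟨hLmem i, hbi i, ReesCurve.linearPair_syzForm_mem_span hP2 i⟩,
    ⟨⟨b, hb, hD⟩, ⟨-b, neg_ne_zero.2 hb, ?_⟩⟩,
    ⟨ReesCurve.linearIndependent_of_linDet_ne_zero hD0,
      ReesCurve.span_eq_reesIdealOne (fun i => (hbi i).1) hLmem hE hb hD⟩, fun i => ?_⟩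
  · rw [ReesCurve.resT_one_one (hbi 0).1 (hbi 1).1, hD, C_neg, neg_mul]
  · have hDX := ReesCurve.isDX_linearPair hP hP2 hM i
    exact ⟨⟨_, hDX⟩, fun H hH => ⟨_, ReesCurve.syzForm_dvd_sub_of_isDX hP2 hH hDX⟩⟩
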